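/- **Setting.** Let $C_2\subseteq C_1\subseteq\mathbb F_q^n$ be linear codes, let $\vec b_1,\dots,\vec b_{k_2}$ be a basis of $C_2$ and $\vec b_1,\dots,\vec b_{k_2+\ell}$ a basis of $C_1$. In the corresponding linear ramp secret sharing scheme a secret $\vec x\in\mathbb F_q^\ell$ is encoded, with uniformly random $\vec a\in\mathbb F_q^{k_2}$, as $\vec c=\sum_{i\le k_2}a_i\vec b_i+\sum_{i\le\ell}x_i\vec b_{k_2+i}$, and $c_p$ is the share of participant $p$. If $N$ secrets are compatible with the shares of a set $A$ of participants, then $A$ holds $\ell-\log_q N$ $q$-bits of information. The set $A$ is *non-$i$-qualifying* if it cannot recover $i$ $q$-bits of information, and *maximum non-$i$-qualifying* if it is of largest size among the non-$i$-qualifying sets. The reconstruction number $r_i$ is the smallest $r$ such that any set of $r$ participants can recover $i$ $q$-bits. The relative generalized Hamming weight $M_t(C_1,C_2)$ is the minimum of $\#\mathrm{Supp}(W)$ over the subspaces $W\subseteq C_1$ with $W\cap C_2=\{\vec 0\}$ and $\dim W=t$, where $\mathrm{Supp}(W)$ is the set of coordinates in which some word of $W$ is non-zero. Let $S_1,\dots,S_m\subseteq\mathbb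 F_q$ with $s_i=\#S_i$, and let $0\le v_i<j_i<s_i$ be integers. The participants are the points of $S_1\times\cdots\times S_m$. Put $\Delta=\{X_1^{i_1}\cdots X_m^{i_m}\mid 0\le i_t<s_t\}$, $L_1=\{X_1^{i_1}\cdots X_m^{i_m}\mid 0\le i_t\le j_t\}$, $\Box=\{X_1^{i_1}\cdots X_m^{i_m}\mid v_t\le i_t\le j_t\}$, $L_2=L_1\setminus\Box$, and $\Diamond=\{M\in L_1\mid X_1^{v_1}\cdots X_m^{v_m}\preceq M\}$, where $\prec$ is the lexicographic ordering with $X_m\prec\cdots\prec X_1$. For a set $L$ of monomials let $C(L)$ be the span of the evaluation vectors of its members on $S_1\times\cdots\times S_m$; for a set $K$ of monomials let $D(K)$ be the number of members of $\Delta$ that are divisible by some member of $K$. The scheme defined from $C_2=C(L_2)\subseteq C(L_1)=C_1$ is called *considerate* if for every $i=1,\dots,\#\Box$, among the sets $K\subseteq\Diamond$ of size $i$ the minimum of $D(K)$ is attained by some $K'\subseteq\Box$. **Theorem.** Consider a considerate scheme with $m\ge 2$ variables and $s=s_1=\cdots=s_m$, $v=v_1=\cdots=v_m$, $j=j_1=\cdots=j_m$.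 There are $s^m$ participants, and the secret is of size $\ell=(j-v+1)^m$. Let $a,b\ge 0$ with $a+b=m$ and $e=z^a(z-1)^b$, where $1\le z\le j-v+1$ if $b=0$ and $2\le z\le j-v+1$ if $b>0$. Then $$M_e(C_1,C_2)=(s-j-1+z)^a(s-j-2+z)^b,$$ $$r_{\ell-e+1}=s^m-(s-j-1+z)^a(s-j-2+z)^b+1.$$ Moreover, let $T_i\subseteq S_i$ ($i=1,\dots,m$) be sets of which $a$ have size $s-j-1+z$ and the remaining $b$ have size $s-j-2+z$. Then the set $(S_1\times\cdots\times S_m)\setminus(T_1\times\cdots\times T_m)$ of participants holds at most $\ell-e$ $q$-bits of information, and it is a maximum non-$(\ell-e+1)$-qualifying set. -/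

import Mathlib

/-- A linear ramp secret sharing scheme in its coset form: nested codes `C₂ ⊆ C₁ ⊆ F^ι`
(the participants are the elements of `ι`), a basis `b₁, …, b_{k₂}` of `C₂`, and an extension of
it by `ℓ` further vectors to a basis of `C₁`. -/
structure CosetScheme {F ι : Type*} [Field F] (C₂ C₁ : Submodule F (ι → F)) where
  k₂ : ℕ
  ℓ : ℕ
  basis₂ : Module.Basis (Fin k₂) F C₂
  basis₁ : Module.Basis (Fin k₂ ⊕ Fin ℓ) F C₁
  basis₁_inl : ∀ i, (basis₁ (Sum.inl i) : ι → F) = basis₂ i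

namespace CosetScheme

variable {F ι : Type*} [Field F] {C₂ C₁ : Submodule F (ι → F)}

/-- The share vector of the secret `x` when the randomness is `a`. -/
noncomputable def encode (P : CosetScheme C₂ C₁) (a : Fin P.k₂ → F) (x : Fin P.ℓ → F) : ι → F :=
  ∑ i, a i • (P.basis₁ (Sum.inl i) : ι → F) + ∑ i, x i • (P.basis₁ (Sum.inr i) : ι → F)

/-- The secrets that are compatible with the shares `c p`, `p ∈ A`. -/
noncomputable def possibleSecrets (P : CosetScheme C₂ C₁) (A : Finset ι) (c : ι → F) : Set (Fin P.ℓ → F) :=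
  {x | ∃ a : Fin P.k₂ → F, ∀ p ∈ A, P.encode a x p = c p}

/-- The amount of information, in `q`-bits (`q = #F`), that the participants in `A` hold about
the secret when the share vector is `c`: the length `ℓ` of the secret minus the uncertainty, which
is the logarithm to base `q` of the number of secrets that are still possible. -/
noncomputable def information [Fintype F] (P : CosetScheme C₂ C₁) (A : Finset ι) (c : ι → F) : ℝ :=
  P.ℓ - Real.logb (Fintype.card F) ((P.possibleSecrets A c).ncard)

/-- The set `A` of participants can recover `i` `q`-bits of information, for all share vectors
that can be dealt. -/
def CanRecover [Fintype F] (P : CosetScheme C₂ C₁) (A : Finset ι) (i : ℕ) : Prop :=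
  ∀ (a : Fin P.k₂ → F) (x : Fin P.ℓ → F), (i : ℝ) ≤ P.information A (P.encode a x)

/-- `A` is non-`i`-qualifying. -/
def NonQualifying [Fintype F] (P : CosetScheme C₂ C₁) (i : ℕ) (A : Finset ι) : Prop :=
  ¬ P.CanRecover A i

/-- `A` is maximum non-`i`-qualifying: of largest size among the non-`i`-qualifying sets. -/
def MaximumNonQualifying [Fintype F] (P : CosetScheme C₂ C₁) (i : ℕ) (A : Finset ι) : Prop :=
  P.NonQualifying i A ∧ ∀ B : Finset ι, P.NonQualifying i B → B.card ≤ A.card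

/-- `r` is the `i`-th reconstruction number `r_i`: the smallest number such that any set of `r`
participants can recover `i` `q`-bits of information. -/
def IsReconstructionNumber [Fintype F] (P : CosetScheme C₂ C₁) (i r : ℕ) : Prop :=
  IsLeast {r : ℕ | ∀ A : Finset ι, A.card = r → P.CanRecover A i} r

end CosetScheme

/-- The support of a space of words. -/
def codeSupport {F ι : Type*} [Field F] (W : Submodule F (ι → F)) : Set ι :=
  {p | ∃ c ∈ W, c p ≠ 0}

/-- `w` is the `t`-th relative generalized Hamming weight `M_t(C₁, C₂)`. -/
def IsRelGenHammingWeight {F ι : Type*} [Field F] (C₁ C₂ : Submodule F (ι → F)) (t w : ℕ) : Prop :=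
  IsLeast {w : ℕ | ∃ W : Submodule F (ι → F),
    W ≤ C₁ ∧ W ⊓ C₂ = ⊥ ∧ Module.finrank F W = t ∧ (codeSupport W).ncard = w} w

namespace MonomialCartesian

variable {m : ℕ} {F : Type*} [Field F]

/-- The point set `S₁ × ⋯ × S_m`, which is the set of participants. -/
abbrev Point (S : Fin m → Finset F) : Type _ := ∀ i, {x : F // x ∈ S i}

/-- The evaluation map. (It is constant modulo the vanishing ideal of the point set.) -/
noncomputable def ev (S : Fin m → Finset F) : MvPolynomial (Fin m) F →ₗ[F] (Point S → F) where
  toFun f := fun p => MvPolynomial.eval (fun i => (p i : F)) f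
  map_add' f g := by ext p; simp
  map_smul' c f := by ext p; simp [MvPolynomial.smul_eval]

/-- The monomial `X₁^{e₁} ⋯ X_m^{e_m}`. Sets of monomials are given as sets of exponents. -/
noncomputable def mono (F : Type*) [Field F] (e : Fin m → ℕ) : MvPolynomial (Fin m) F :=
  ∏ i, MvPolynomial.X i ^ e i

/-- The code `C(L)`. -/
noncomputable def code (S : Fin m → Finset F) (L : Finset (Fin m → ℕ)) :
    Submodule F (Point S → F) :=
  (Submodule.span F (mono F '' (L : Set (Fin m → ℕ)))).map (ev S)

/-- `Δ(s₁, …, s_m)` with `s_i = #S_i`. -/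
def delta (S : Fin m → Finset F) : Finset (Fin m → ℕ) :=
  Fintype.piFinset fun i => Finset.range (S i).card

open Classical in
/-- `D(K)`, the number of monomials in `Δ(s₁, …, s_m)` that are divisible by some member of `K`. -/
noncomputable def D (S : Fin m → Finset F) (K : Finset (Fin m → ℕ)) : ℕ :=
  ((delta S).filter fun N => ∃ M ∈ K, M ≤ N).card

/-- `L₁`, the monomials with all exponents `i_t ≤ j_t`. -/
def L₁ (j : Fin m → ℕ) : Finset (Fin m → ℕ) := Finset.Icc 0 j

/-- `□`, the monomials with all exponents `v_t ≤ i_t ≤ j_t`. -/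
def box (v j : Fin m → ℕ) : Finset (Fin m → ℕ) := Finset.Icc v j

/-- `L₂ = L₁ \ □`. -/
def L₂ (v j : Fin m → ℕ) : Finset (Fin m → ℕ) := L₁ j \ box v j

open Classical in
/-- `◇`, the members of `L₁` that are at least `X₁^{v₁} ⋯ X_m^{v_m}` in the lexicographic ordering
with `X_m ≺ ⋯ ≺ X₁`. -/
noncomputable def diamond (v j : Fin m → ℕ) : Finset (Fin m → ℕ) :=
  (L₁ j).filter fun M => toLex v ≤ toLex M

/-- The scheme with codes `C(L₂) ⊆ C(L₁)` given by `S`, `v`, `j` is considerate. -/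
def Considerate (S : Fin m → Finset F) (v j : Fin m → ℕ) : Prop :=
  (∀ i, v i < j i ∧ j i < (S i).card) ∧
  ∀ i, 1 ≤ i → i ≤ (box v j).card →
    ∃ K' ⊆ box v j, K'.card = i ∧ ∀ K ⊆ diamond v j, K.card = i → D S K' ≤ D S K

open Classical in
/-- `(S₁ × ⋯ × S_m) \ (T₁ × ⋯ × T_m)`. -/
noncomputable def removeProduct (S T : Fin m → Finset F) : Finset (Point S) :=
  Finset.univ.filter fun p => ¬ ∀ i, (p i : F) ∈ T i

end MonomialCartesian

/-! ### Isoperimetry in the grid: lower bounds for `A + {0, …, c}^m`. -/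

section IsoperimetricGrid

/-! Everything reduces to M_e. A set of participants leaves an e-dimensional space of secrets
undetermined exactly if some e-dimensional W ≤ C₁ with W ⊓ C₂ = ⊥ vanishes on it
(`nonQualifying_iff` and the two lemmas that pass between `hiddenSecrets` and such W). So the
largest non-(ℓ-e+1)-qualifying sets are the complements of the smallest supports of such W.

Lower bound. The leading monomials of W lie in ◇, and their multiples in Δ bound the support from
below (`exists_subset_diamond_D_le`). Considerateness replaces them by e monomials in the box. These
have exponents at most j, so their shifts by vectors of {0, …, c}^m with c = s-1-j remain in Δ. What
remains is to show that a set of z^a(z-1)^b lattice points has at least (c+z)^a(c+z-1)^b points in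
its sum with {0, …, c}^m, as if it were a box with sides z and z-1. This takes two steps. Slicing
and induction on the dimension bound the sum by `envelope`, in which all sides of the box but one
are integers and the last is real (`envelope_card_le_card_thicken`). Convexity of log(c + exp x)
then shows that the factors z and z-1 are optimal (`pow_mul_pow_le_mul_prod`).

Upper bound. Products of univariate polynomials vanishing on S_i \ T_i, multiplied by small
monomials, span a W with support T₁ × ⋯ × T_m (`exists_submodule_codeSupport_eq`). -/

/-- `A + {0, …, c}^m`. -/
def thicken (c : ℕ) {m : ℕ} (A : Finset (Fin m → ℕ)) : Finset (Fin m → ℕ) :=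
  Finset.image₂ (· + ·) A (Fintype.piFinset fun _ => Finset.range (c + 1))

theorem mem_thicken {c m : ℕ} {A : Finset (Fin m → ℕ)} {N : Fin m → ℕ} :
    N ∈ thicken c A ↔ ∃ M ∈ A, ∀ i, M i ≤ N i ∧ N i ≤ M i + c := by
  simp only [thicken, Finset.mem_image₂, Fintype.mem_piFinset, Finset.mem_range]
  constructor
  · rintro ⟨M, hM, w, hw, rfl⟩
    refine ⟨M, hM, fun i => ?_⟩
    have := hw i
    simp only [Pi.add_apply]
    omega
  · rintro ⟨M, hM, h⟩
    refine ⟨M, hM, fun i => N i - M i, fun i => ?_, ?_⟩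
    · have := h i
      dsimp only
      omega
    · ext i
      have := h i
      simp only [Pi.add_apply]
      omega

/-- The section of `A` at height `k` in the first coordinate. -/
def layer {m : ℕ} (A : Finset (Fin (m + 1) → ℕ)) (k : ℕ) : Finset (Fin m → ℕ) :=
  (A.filter fun x => x 0 = k).image Fin.tail

theorem mem_layer {m : ℕ} {A : Finset (Fin (m + 1) → ℕ)} {k : ℕ} {x : Fin m → ℕ} :
    x ∈ layer A k ↔ Fin.cons k x ∈ A := by
  simp only [layer, Finset.mem_image, Finset.mem_filter]
  constructor
  · rintro ⟨y, ⟨hy, rfl⟩, rfl⟩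
    rwa [Fin.cons_self_tail]
  · intro h
    exact ⟨_, ⟨h, by simp⟩, by simp⟩

theorem card_layer {m : ℕ} (A : Finset (Fin (m + 1) → ℕ)) (k : ℕ) :
    (layer A k).card = (A.filter fun x => x 0 = k).card := by
  apply Finset.card_image_of_injOn
  intro x hx y hy hxy
  rw [Finset.mem_coe, Finset.mem_filter] at hx hy
  rw [← Fin.cons_self_tail x, ← Fin.cons_self_tail y, hxy, hx.2, hy.2]

theorem sum_card_layer {m : ℕ} (A : Finset (Fin (m + 1) → ℕ)) :
    ∑ k ∈ A.image (fun x => x 0), (layer A k).card = A.card := by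
  simp only [card_layer]
  exact (Finset.card_eq_sum_card_image _ _).symm

theorem sum_card_layer_le {m : ℕ} (A : Finset (Fin (m + 1) → ℕ)) (J : Finset ℕ) :
    ∑ k ∈ J, (layer A k).card ≤ A.card := by
  simp only [card_layer]
  rw [← Finset.card_biUnion]
  · exact Finset.card_le_card (Finset.biUnion_subset.2 fun _ _ => Finset.filter_subset _ _)
  · intro k _ l _ hkl
    rw [Function.onFun, Finset.disjoint_filter]
    rintro x _ rfl h
    exact hkl h

theorem thicken_layer_subset {c m : ℕ} (A : Finset (Fin (m + 1) → ℕ)) {i k : ℕ} (h1 : i ≤ k)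
    (h2 : k ≤ i + c) : thicken c (layer A i) ⊆ layer (thicken c A) k := by
  intro x hx
  obtain ⟨M, hM, h⟩ := mem_thicken.1 hx
  refine mem_layer.2 (mem_thicken.2 ⟨_, mem_layer.1 hM, fun t => ?_⟩)
  refine Fin.cases ?_ (fun t => ?_) t
  · simpa using ⟨h1, h2⟩
  · simpa using h t

/-- Disjoint heights are assigned to the sections: those below `k` stay in place, those from `k` on
are lifted by `c`, and the gap k, …, k+c-1 is filled with copies of section `k`. -/
theorem card_thicken_ge {c m : ℕ} (A : Finset (Fin (m + 1) → ℕ)) (H : Finset ℕ) (k : ℕ) :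
    c * (thicken c (layer A k)).card + ∑ i ∈ H, (thicken c (layer A i)).card
      ≤ (thicken c A).card := by
  set J₁ := H.filter (· < k)
  set J₂ := Finset.Ico k (k + c)
  set J₃ := (H.filter fun i => ¬ i < k).image (· + c)
  have h12 : Disjoint J₁ J₂ := by
    rw [Finset.disjoint_left]
    intro i hi hi'
    simp only [J₁, J₂, Finset.mem_filter, Finset.mem_Ico] at hi hi'
    omega
  have h123 : Disjoint (J₁ ∪ J₂) J₃ := by
    rw [Finset.disjoint_left]
    intro i hi hi'
    simp only [J₁, J₂, J₃, Finset.mem_union, Finset.mem_filter, Finset.mem_Ico,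
      Finset.mem_image] at hi hi'
    obtain ⟨i', hi', rfl⟩ := hi'
    omega
  have h1 : ∑ i ∈ J₁, (thicken c (layer A i)).card ≤ ∑ i ∈ J₁, (layer (thicken c A) i).card :=
    Finset.sum_le_sum fun i _ => Finset.card_le_card (thicken_layer_subset A le_rfl (by omega))
  have h2 : c * (thicken c (layer A k)).card ≤ ∑ i ∈ J₂, (layer (thicken c A) i).card := by
    have : c * (thicken c (layer A k)).card = ∑ i ∈ J₂, (thicken c (layer A k)).card := by
      simp [J₂]
    rw [this]
    refine Finset.sum_le_sum fun i hi => Finset.card_le_card (thicken_layer_subset A ?_ ?_) <;>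
    · simp only [J₂, Finset.mem_Ico] at hi
      omega
  have h3 : ∑ i ∈ H.filter (fun i => ¬ i < k), (thicken c (layer A i)).card
      ≤ ∑ i ∈ J₃, (layer (thicken c A) i).card := by
    rw [Finset.sum_image (by intro x _ y _ h; simpa using h)]
    exact Finset.sum_le_sum fun i _ =>
      Finset.card_le_card (thicken_layer_subset A (by omega) le_rfl)
  have h4 := sum_card_layer_le (thicken c A) (J₁ ∪ J₂ ∪ J₃)
  rw [Finset.sum_union h123, Finset.sum_union h12] at h4
  have h5 : ∑ i ∈ J₁, (thicken c (layer A i)).card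
      + ∑ i ∈ H.filter (fun i => ¬ i < k), (thicken c (layer A i)).card
      = ∑ i ∈ H, (thicken c (layer A i)).card := Finset.sum_filter_add_sum_filter_not H (· < k) _
  omega

theorem ConcaveOn.add_le_add_of_le {G : ℝ → ℝ} (hG : ConcaveOn ℝ (Set.Ici 0) G) {p u w q : ℝ}
    (hp : 0 ≤ p) (hpu : p ≤ u) (huq : u ≤ q) (hsum : u + w = p + q) :
    G p + G q ≤ G u + G w := by
  rcases eq_or_lt_of_le (hpu.trans huq) with h | h
  · have h1 : u = p := le_antisymm (by linarith) hpu
    have h2 : w = q := by linarith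
    rw [h1, h2]
  · have hd : 0 < q - p := by linarith
    set t := (u - p) / (q - p)
    have ht0 : 0 ≤ t := div_nonneg (by linarith) hd.le
    have ht1 : t ≤ 1 := (div_le_one hd).2 (by linarith)
    have htd : t * (q - p) = u - p := div_mul_cancel₀ _ hd.ne'
    have hq : q ∈ Set.Ici (0 : ℝ) := by simp only [Set.mem_Ici]; linarith
    have e1 := hG.2 (Set.mem_Ici.2 hp) hq (sub_nonneg.2 ht1) ht0 (by ring)
    have e2 := hG.2 (Set.mem_Ici.2 hp) hq ht0 (sub_nonneg.2 ht1) (by ring)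
    simp only [smul_eq_mul] at e1 e2
    rw [show (1 - t) * p + t * q = u by linarith] at e1
    rw [show t * p + (1 - t) * q = w by linarith] at e2
    linarith

/-- Greedy packing into containers of size `X`: pushing two values apart with fixed sum lowers a sum
of concave values, so the remainder `r` absorbs each `x i`, and whatever exceeds `X` becomes the new
remainder. The extra `X` is the largest value, which the application removes from `H`. -/
theorem ConcaveOn.exists_mul_add_le_sum {ι : Type*} {G : ℝ → ℝ} (hG : ConcaveOn ℝ (Set.Ici 0) G)
    (hG0 : 0 ≤ G 0) {X : ℝ} (hX : 0 ≤ X) (x : ι → ℝ) (H : Finset ι)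
    (hx : ∀ i ∈ H, 0 ≤ x i ∧ x i ≤ X) :
    ∃ (q : ℕ) (r : ℝ), 0 ≤ r ∧ r ≤ X ∧ X + ∑ i ∈ H, x i = q * X + r ∧
      q * G X + G r ≤ G X + ∑ i ∈ H, G (x i) := by
  classical
  induction H using Finset.induction_on with
  | empty => exact ⟨0, X, hX, le_rfl, by simp, by simp⟩
  | insert i H hi ih =>
    obtain ⟨q, r, hr0, hrX, h1, h2⟩ := ih fun k hk => hx k (Finset.mem_insert_of_mem hk)
    obtain ⟨hi0, hiX⟩ := hx i (Finset.mem_insert_self i H)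
    rw [Finset.sum_insert hi, Finset.sum_insert hi]
    rcases le_total (r + x i) X with h | h
    · refine ⟨q, r + x i, by linarith, h, by linarith, ?_⟩
      have := hG.add_le_add_of_le (p := 0) (u := r) (w := x i) (q := r + x i) le_rfl hr0
        (by linarith) (by ring)
      linarith
    · refine ⟨q + 1, r + x i - X, by linarith, by linarith, ?_, ?_⟩
      · push_cast
        linarith
      · have := hG.add_le_add_of_le (p := r + x i - X) (u := r) (w := x i) (q := X) (by linarith)
          (by linarith) hrX (by ring)
        push_cast
        linarith

/-- Sections of unequal size are no better than `h + 1` equal ones. The packing leaves q values `X`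
and a remainder, and concavity bounds this below by an average of the costs for q + 1 and for q
equal sections; the cheaper of the two gives `h`. -/
theorem ConcaveOn.exists_mul_apply_div_le {ι : Type*} [DecidableEq ι] {G : ℝ → ℝ}
    (hG : ConcaveOn ℝ (Set.Ici 0) G)
    (hG0 : ∀ y, 0 ≤ y → 0 ≤ G y) {c : ℝ} (hc : 0 ≤ c) (x : ι → ℝ) (H : Finset ι) (k : ι)
    (hk : k ∈ H) (hk0 : 0 < x k) (hx : ∀ i ∈ H, 0 ≤ x i ∧ x i ≤ x k) :
    ∃ h : ℕ, (c + (h + 1)) * G ((∑ i ∈ H, x i) / (h + 1)) ≤ c * G (x k) + ∑ i ∈ H, G (x i) := by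
  obtain ⟨q, r, hr0, hrX, h1, h2⟩ := hG.exists_mul_add_le_sum (hG0 0 le_rfl) hk0.le x (H.erase k)
    fun i hi => hx i (Finset.mem_of_mem_erase hi)
  rw [Finset.add_sum_erase H x hk] at h1
  rw [Finset.add_sum_erase H (fun i => G (x i)) hk] at h2
  set X := x k
  set n := ∑ i ∈ H, x i
  have hnX : X ≤ n := Finset.single_le_sum (f := x) (fun i hi => (hx i hi).1) hk
  rcases Nat.eq_zero_or_pos q with rfl | hq
  · have hrX' : r = X := le_antisymm hrX (by simpa [h1] using hnX)
    refine ⟨0, ?_⟩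
    have : n = X := by simpa [hrX'] using h1
    rw [this]
    simp only [Nat.cast_zero, zero_add, div_one, zero_mul] at h2 ⊢
    rw [hrX'] at h2
    linarith
  · have hq' : (0 : ℝ) < q := by exact_mod_cast hq
    have hn : 0 < n := by linarith
    -- `X` is the convex combination of `n / (q + 1)` and `n / q` with weights `l`, `1 - l`
    set l := (q + 1) * r / n
    have hln : l * n = (q + 1) * r := div_mul_cancel₀ _ hn.ne'
    have hl0 : 0 ≤ l := by positivity
    have hl1 : l ≤ 1 := by
      rw [div_le_one hn]
      nlinarith
    have mem1 : n / (q + 1) ∈ Set.Ici (0 : ℝ) := by simp only [Set.mem_Ici]; positivity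
    have mem2 : n / q ∈ Set.Ici (0 : ℝ) := by simp only [Set.mem_Ici]; positivity
    have e1 := hG.2 mem1 mem2 hl0 (sub_nonneg.2 hl1) (by ring)
    have e2 := hG.2 mem1 (Set.mem_Ici.2 le_rfl) hl0 (sub_nonneg.2 hl1) (by ring)
    simp only [smul_eq_mul, mul_zero, add_zero] at e1 e2
    have hr : l * (n / (q + 1)) = r := by
      rw [← mul_div_assoc, hln]
      field_simp
    have hX : l * (n / (q + 1)) + (1 - l) * (n / q) = X := by
      rw [hr]
      have : (1 - l) * (n / q) = (n - l * n) / q := by ring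
      rw [this, hln, h1]
      field_simp
      ring
    rw [hX] at e1
    rw [hr] at e2
    have hG00 := mul_nonneg (sub_nonneg.2 hl1) (hG0 0 le_rfl)
    have key : l * ((c + (q + 1)) * G (n / (q + 1))) + (1 - l) * ((c + q) * G (n / q)) ≤
        c * G X + ∑ i ∈ H, G (x i) := by
      have e3 := mul_le_mul_of_nonneg_left e1 (add_nonneg hc hq'.le)
      nlinarith
    rcases le_total ((c + (q + 1)) * G (n / (q + 1))) ((c + q) * G (n / q)) with h | h
    · refine ⟨q, ?_⟩
      nlinarith [mul_le_mul_of_nonneg_left h (sub_nonneg.2 hl1)]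
    · refine ⟨q - 1, ?_⟩
      rw [Nat.cast_sub hq, Nat.cast_one, sub_add_cancel]
      nlinarith [mul_le_mul_of_nonneg_left h hl0]

/-- The infimum of `(c + x₁) ⋯ (c + x_d) (c + t)` over the positive integers `x₁, …, x_d` and the
real `t` with `x₁ ⋯ x_d t = y`. -/
noncomputable def envelope (c : ℝ) (d : ℕ) (y : ℝ) : ℝ :=
  ⨅ x : Fin d → ℕ, (∏ i, (c + (x i + 1))) * (c + y / ∏ i, ((x i : ℝ) + 1))

theorem envelope_bddBelow {c : ℝ} (hc : 0 ≤ c) (d : ℕ) {y : ℝ} (hy : 0 ≤ y) :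
    BddBelow (Set.range fun x : Fin d → ℕ =>
      (∏ i, (c + (x i + 1))) * (c + y / ∏ i, ((x i : ℝ) + 1))) := by
  refine ⟨0, ?_⟩
  rintro _ ⟨x, rfl⟩
  positivity

theorem envelope_nonneg {c : ℝ} (hc : 0 ≤ c) (d : ℕ) (y : ℝ) (hy : 0 ≤ y) : 0 ≤ envelope c d y :=
  Real.iInf_nonneg fun x => by positivity

/-- Each term of the infimum is affine in `y`. Allowing one real side is what makes the bound
concave, hence usable in the induction. -/
theorem concaveOn_envelope {c : ℝ} (hc : 0 ≤ c) (d : ℕ) :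
    ConcaveOn ℝ (Set.Ici 0) (envelope c d) := by
  refine ⟨convex_Ici 0, ?_⟩
  intro y hy y' hy' p q hp hq hpq
  refine le_ciInf fun x => ?_
  have e1 := mul_le_mul_of_nonneg_left (ciInf_le (envelope_bddBelow hc d hy) x) hp
  have e2 := mul_le_mul_of_nonneg_left (ciInf_le (envelope_bddBelow hc d hy') x) hq
  simp only [smul_eq_mul]
  refine (add_le_add e1 e2).trans (le_of_eq ?_)
  have : q = 1 - p := by linarith
  subst this
  ring

theorem envelope_zero (c y : ℝ) : envelope c 0 y = c + y := by
  simp [envelope]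

theorem envelope_succ_le {c : ℝ} (hc : 0 ≤ c) (d h : ℕ) {y : ℝ} (hy : 0 ≤ y) :
    envelope c (d + 1) y ≤ (c + (h + 1)) * envelope c d (y / (h + 1)) := by
  rw [envelope, envelope, Real.mul_iInf_of_nonneg (by positivity)]
  refine le_ciInf fun x => ?_
  refine (ciInf_le (envelope_bddBelow hc (d + 1) hy) (Fin.cons h x)).trans (le_of_eq ?_)
  simp only [Fin.prod_univ_succ, Fin.cons_zero, Fin.cons_succ]
  rw [div_div]
  ring

theorem envelope_card_le_card_thicken (c d : ℕ) (A : Finset (Fin (d + 1) → ℕ)) (hA : A.Nonempty) :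
    envelope c d A.card ≤ (thicken c A).card := by
  induction d with
  | zero =>
    rw [envelope_zero]
    obtain ⟨x, hx⟩ := hA
    have hl : ∀ k ∈ A.image (fun x => x 0),
        (layer A k).card = 1 ∧ (thicken c (layer A k)).card = 1 := by
      intro k hk
      obtain ⟨y, hy, rfl⟩ := Finset.mem_image.1 hk
      have h1 : Fin.tail y ∈ layer A (y 0) := by
        rw [mem_layer, Fin.cons_self_tail]
        exact hy
      have h2 : Fin.tail y ∈ thicken c (layer A (y 0)) :=
        mem_thicken.2 ⟨_, h1, fun i => i.elim0⟩
      constructor <;> rw [Finset.card_eq_one]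
      · exact ⟨_, Finset.eq_singleton_iff_unique_mem.2 ⟨h1, fun _ _ => Subsingleton.elim _ _⟩⟩
      · exact ⟨_, Finset.eq_singleton_iff_unique_mem.2 ⟨h2, fun _ _ => Subsingleton.elim _ _⟩⟩
    have h := card_thicken_ge (c := c) A (A.image (fun x => x 0)) (x 0)
    rw [(hl _ (Finset.mem_image_of_mem _ hx)).2, Finset.sum_congr rfl fun k hk => (hl k hk).2,
      ← Finset.sum_congr rfl fun k hk => (hl k hk).1, sum_card_layer] at h
    exact_mod_cast (by omega : c + A.card ≤ _)
  | succ d ih =>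
    set H := A.image (fun x => x 0)
    have hne : ∀ k ∈ H, (layer A k).Nonempty := by
      intro k hk
      obtain ⟨y, hy, rfl⟩ := Finset.mem_image.1 hk
      exact ⟨Fin.tail y, by rwa [mem_layer, Fin.cons_self_tail]⟩
    obtain ⟨k, hk, hmax⟩ := H.exists_max_image (fun i => (layer A i).card) (hA.image _)
    have hc : (0 : ℝ) ≤ c := Nat.cast_nonneg c
    -- The largest section serves as section `k`; the number `h + 1` of equalized sections becomes a
    -- new integer side.
    obtain ⟨h, hh⟩ := (concaveOn_envelope hc d).exists_mul_apply_div_le (envelope_nonneg hc d) hc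
      (fun i => ((layer A i).card : ℝ)) H k hk (by exact_mod_cast (hne k hk).card_pos)
      (fun i hi => ⟨Nat.cast_nonneg _, by exact_mod_cast hmax i hi⟩)
    have hsum : ∑ i ∈ H, ((layer A i).card : ℝ) = A.card := by
      exact_mod_cast sum_card_layer A
    rw [hsum] at hh
    refine (envelope_succ_le hc d h (Nat.cast_nonneg _)).trans (hh.trans ?_)
    have h1 : ∑ i ∈ H, envelope c d (layer A i).card
        ≤ ∑ i ∈ H, ((thicken c (layer A i)).card : ℝ) :=
      Finset.sum_le_sum fun i hi => ih _ (hne i hi)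
    have h2 := mul_le_mul_of_nonneg_left (ih _ (hne k hk)) hc
    refine (add_le_add h2 h1).trans ?_
    exact_mod_cast card_thicken_ge A H k

end IsoperimetricGrid

/-! ### Minimizing ∏ (c + y_i) for a prescribed product ∏ y_i. -/

section ProductInequality

/-- Weighted AM-GM is applied to the shares of `c` and of the exponential in c + exp x and c + exp
y; the two arithmetic means add up to 1. -/
theorem convexOn_log_const_add_exp {c : ℝ} (hc : 0 < c) :
    ConvexOn ℝ Set.univ fun x => Real.log (c + Real.exp x) := by
  refine ⟨convex_univ, ?_⟩
  intro x _ y _ p q hp hq hpq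
  simp only [smul_eq_mul]
  have hx : 0 < c + Real.exp x := by positivity
  have hy : 0 < c + Real.exp y := by positivity
  have hA := Real.geom_mean_le_arith_mean2_weighted hp hq
    (div_pos hc hx).le (div_pos hc hy).le hpq
  have hB := Real.geom_mean_le_arith_mean2_weighted hp hq
    (div_pos (Real.exp_pos x) hx).le (div_pos (Real.exp_pos y) hy).le hpq
  rw [Real.div_rpow hc.le hx.le, Real.div_rpow hc.le hy.le] at hA
  rw [Real.div_rpow (Real.exp_pos x).le hx.le, Real.div_rpow (Real.exp_pos y).le hy.le] at hB
  have hxp : 0 < (c + Real.exp x) ^ p := Real.rpow_pos_of_pos hx p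
  have hyq : 0 < (c + Real.exp y) ^ q := Real.rpow_pos_of_pos hy q
  have hcc : c ^ p * c ^ q = c := by rw [← Real.rpow_add hc, hpq, Real.rpow_one]
  have hee : Real.exp x ^ p * Real.exp y ^ q = Real.exp (p * x + q * y) := by
    rw [← Real.exp_mul, ← Real.exp_mul, ← Real.exp_add, mul_comm x, mul_comm y]
  rw [div_mul_div_comm, hcc] at hA
  rw [div_mul_div_comm, hee] at hB
  have hone : p * (c / (c + Real.exp x)) + q * (c / (c + Real.exp y)) +
      (p * (Real.exp x / (c + Real.exp x)) + q * (Real.exp y / (c + Real.exp y))) = 1 := by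
    have hx1 : c / (c + Real.exp x) + Real.exp x / (c + Real.exp x) = 1 := by
      rw [← add_div, div_self hx.ne']
    have hy1 : c / (c + Real.exp y) + Real.exp y / (c + Real.exp y) = 1 := by
      rw [← add_div, div_self hy.ne']
    linear_combination p * hx1 + q * hy1 + hpq
  have hsum := add_le_add hA hB
  rw [hone, ← add_div, div_le_one (by positivity)] at hsum
  have := Real.log_le_log (by positivity) hsum
  rwa [Real.log_mul hxp.ne' hyq.ne', Real.log_rpow hx, Real.log_rpow hy] at this

theorem ConvexOn.secant_le_of_notMem_Ioo {f : ℝ → ℝ} (hf : ConvexOn ℝ Set.univ f) {u w x : ℝ}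
    (huw : u < w) (hx : x ≤ u ∨ w ≤ x) : f u + (f w - f u) / (w - u) * (x - u) ≤ f x := by
  have hwu : 0 < w - u := sub_pos.2 huw
  rcases hx with hx | hx
  · rcases hx.eq_or_lt with rfl | hx
    · simp
    · have h := hf.secant_mono (a := u) (x := x) (y := w) trivial trivial trivial hx.ne huw.ne'
        (hx.trans huw).le
      have h2 := mul_le_mul_of_nonpos_right h (sub_neg.2 hx).le
      rw [div_mul_cancel₀ _ (sub_neg.2 hx).ne] at h2
      linarith
  · have h := hf.secant_mono (a := u) (x := w) (y := x) trivial trivial trivial huw.ne'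
        (huw.trans_le hx).ne' hx
    have h3 : 0 < x - u := by linarith
    have h2 := mul_le_mul_of_nonneg_right h h3.le
    rw [div_mul_cancel₀ _ h3.ne'] at h2
    linarith

/-- Among the factorizations of `w^a u^b` into positive reals outside the interval from `u` to `w`,
that with the factors `u` and `w` minimizes the product of the translates of the factors. -/
theorem pow_mul_pow_le_prod_add {ι : Type*} [Fintype ι] {c u w : ℝ} (hc : 0 ≤ c) (hu : 0 < u)
    (huw : u < w) {a b : ℕ} (hab : a + b = Fintype.card ι) (y : ι → ℝ) (hy0 : ∀ i, 0 < y i)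
    (hy : ∀ i, y i ≤ u ∨ w ≤ y i) (hprod : ∏ i, y i = w ^ a * u ^ b) :
    (c + w) ^ a * (c + u) ^ b ≤ ∏ i, (c + y i) := by
  rcases hc.eq_or_lt with rfl | hc
  · simp [hprod]
  have hw : 0 < w := hu.trans huw
  have hlog : Real.log u < Real.log w := Real.log_lt_log hu huw
  have hsec : ∀ i, Real.log (c + u) + (Real.log (c + w) - Real.log (c + u)) /
      (Real.log w - Real.log u) * (Real.log (y i) - Real.log u) ≤ Real.log (c + y i) := by
    intro i
    have := (convexOn_log_const_add_exp hc).secant_le_of_notMem_Ioo hlog (x := Real.log (y i))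
      ((hy i).imp (Real.log_le_log (hy0 i)) (Real.log_le_log hw))
    simpa only [Real.exp_log hu, Real.exp_log hw, Real.exp_log (hy0 i)] using this
  have hsum := Finset.sum_le_sum fun i (_ : i ∈ Finset.univ) => hsec i
  -- The logarithms of the factors enter the summed secant bounds only through their sum, which the
  -- product determines.
  have hlogprod : ∑ i, Real.log (y i) = a * Real.log w + b * Real.log u := by
    rw [← Real.log_prod fun i _ => (hy0 i).ne', hprod, Real.log_mul (by positivity) (by positivity),
      Real.log_pow, Real.log_pow]
  rw [Finset.sum_add_distrib, ← Finset.mul_sum, Finset.sum_sub_distrib, hlogprod] at hsum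
  simp only [Finset.sum_const, Finset.card_univ, nsmul_eq_mul, ← hab] at hsum
  have hcy : ∀ i, 0 < c + y i := fun i => add_pos hc (hy0 i)
  rw [← Real.log_le_log_iff (by positivity) (Finset.prod_pos fun i _ => hcy i),
    Real.log_prod fun i _ => (hcy i).ne', Real.log_mul (by positivity) (by positivity),
    Real.log_pow, Real.log_pow]
  refine le_trans (le_of_eq ?_) hsum
  have hd : Real.log w - Real.log u ≠ 0 := (sub_pos.2 hlog).ne'
  have : (a : ℝ) * Real.log w + b * Real.log u - ((a + b : ℕ) : ℝ) * Real.log u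
      = a * (Real.log w - Real.log u) := by
    push_cast
    ring
  rw [this]
  field_simp
  push_cast
  ring

theorem prod_update_eq {ι : Type*} [Fintype ι] [DecidableEq ι] {M : Type*} [CommMonoid M]
    (f : ℕ → M) (x : ι → ℕ) (i : ι) (k : ℕ) :
    ∏ l, f (Function.update x i k l) = f k * ∏ l ∈ Finset.univ.erase i, f (x l) := by
  rw [← Finset.mul_prod_erase _ _ (Finset.mem_univ i), Function.update_self]
  congr 1
  exact Finset.prod_congr rfl fun l hl => by
    rw [Function.update_of_ne (Finset.ne_of_mem_erase hl)]

/-- Moving one integer factor `x i` to `k` and adapting the real factor. -/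
theorem le_prod_of_le_prod_update {ι : Type*} [Fintype ι] [DecidableEq ι] {c n t N : ℝ}
    (hc : 0 ≤ c) (x : ι → ℕ) (i : ι) (k : ℕ) (hk : 0 < k)
    (hn : t * ∏ l, (x l : ℝ) = n)
    (hmove : ((x i : ℝ) - k) * (t - k) ≤ 0)
    (hup : ∀ t', t' = x i * t / k → t' * ∏ l, ((Function.update x i k l : ℕ) : ℝ) = n →
      N ≤ (c + t') * ∏ l, (c + (Function.update x i k l : ℕ))) :
    N ≤ (c + t) * ∏ l, (c + (x l : ℝ)) := by
  have hk' : (0 : ℝ) < k := by exact_mod_cast hk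
  have hup' := hup _ rfl (by
    rw [prod_update_eq (fun k => (k : ℝ)), ← hn,
      ← Finset.mul_prod_erase _ _ (Finset.mem_univ i)]
    field_simp)
  rw [prod_update_eq (fun k => c + (k : ℝ))] at hup'
  refine hup'.trans ?_
  rw [← Finset.mul_prod_erase _ _ (Finset.mem_univ i), ← mul_assoc, ← mul_assoc]
  refine mul_le_mul_of_nonneg_right ?_ (Finset.prod_nonneg fun l _ => by positivity)
  -- The move preserves the product of the two factors, so only their sum matters, and it does not
  -- grow because `k` lies between `x i` and `t`.
  have h1 : x i * t / k * k = x i * t := div_mul_cancel₀ _ hk'.ne'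
  have h2 : x i * t / k + k ≤ x i + t := by
    rw [← mul_le_mul_iff_of_pos_right hk', add_mul, h1]
    nlinarith
  nlinarith [mul_le_mul_of_nonneg_left h2 hc]

/-- Integers avoid the open interval (z-1, z), so only `t` can violate the hypothesis of
`pow_mul_pow_le_prod_add`. As long as it does, an integer outside {z-1, z} can move one step towards
that pair without increasing the right-hand side. -/
theorem pow_mul_pow_le_mul_prod_of_two_le {d a b z : ℕ} (hz : 2 ≤ z) (hab : a + b = d + 1) {c : ℝ}
    (hc : 0 ≤ c) (x : Fin d → ℕ) (hx : ∀ i, 0 < x i) (t : ℝ) (ht : 0 < t)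
    (hn : t * ∏ i, (x i : ℝ) = (z : ℝ) ^ a * ((z : ℝ) - 1) ^ b) :
    (c + z) ^ a * (c + (z - 1)) ^ b ≤ (c + t) * ∏ i, (c + (x i : ℝ)) := by
  induction h : ∑ i, ((x i - z) + (z - 1 - x i)) using Nat.strong_induction_on
    generalizing x t with
  | _ N ih =>
    have hz' : (2 : ℝ) ≤ z := by exact_mod_cast hz
    have hu : (0 : ℝ) < z - 1 := by linarith
    have hint : ∀ i, (x i : ℝ) ≤ z - 1 ∨ (z : ℝ) ≤ x i := by
      intro i
      rcases Nat.lt_or_ge (x i) z with h | h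
      · left
        have : (x i : ℝ) + 1 ≤ z := by exact_mod_cast h
        linarith
      · right
        exact_mod_cast h
    by_cases hout : t ≤ z - 1 ∨ (z : ℝ) ≤ t
    · have := pow_mul_pow_le_prod_add (ι := Fin (d + 1)) hc hu (by linarith : (z : ℝ) - 1 < z)
        (by simpa using hab) (Fin.cons t fun i => (x i : ℝ))
        (fun i => Fin.cases (by simpa using ht) (fun i => by simpa using hx i) i)
        (fun i => Fin.cases (by simpa using hout) (fun i => by simpa using hint i) i)
        (by simpa [Fin.prod_univ_succ] using hn)
      simpa [Fin.prod_univ_succ] using this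
    push Not at hout
    obtain ⟨ht1, ht2⟩ := hout
    -- With truncated subtraction, each summand is the distance from `x i` to {z-1, z}.
    have measure : ∀ (i : Fin d) (k : ℕ), (k - z) + (z - 1 - k) < (x i - z) + (z - 1 - x i) →
        ∑ l, ((Function.update x i k l - z) + (z - 1 - Function.update x i k l)) < N := by
      intro i k hk
      rw [← h]
      refine Finset.sum_lt_sum (fun l _ => ?_) ⟨i, Finset.mem_univ i, by simpa using hk⟩
      by_cases hl : l = i
      · subst hl
        simpa using hk.le
      · rw [Function.update_of_ne hl]
    have step : ∀ (i : Fin d) (k : ℕ), 0 < k → ((x i : ℝ) - k) * (t - k) ≤ 0 →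
        (k - z) + (z - 1 - k) < (x i - z) + (z - 1 - x i) →
        (c + z) ^ a * (c + (z - 1)) ^ b ≤ (c + t) * ∏ i, (c + (x i : ℝ)) := by
      intro i k hk0 hmove hk
      refine le_prod_of_le_prod_update hc x i k hk0 hn hmove fun t' ht' hn' => ?_
      refine ih _ (measure i k hk) _ (fun l => ?_) t' ?_ hn' rfl
      · by_cases hl : l = i
        · subst hl
          simpa using hk0
        · rw [Function.update_of_ne hl]
          exact hx l
      · have : (0 : ℝ) < x i := by exact_mod_cast hx i
        have : (0 : ℝ) < k := by exact_mod_cast hk0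
        rw [ht']
        positivity
    by_cases hbig : ∃ i, z < x i
    · obtain ⟨i, hi⟩ := hbig
      have hi' : (z : ℝ) + 1 ≤ x i := by exact_mod_cast hi
      refine step i (x i - 1) (by omega) ?_ (by omega)
      rw [Nat.cast_sub (hx i), Nat.cast_one]
      nlinarith
    by_cases hsmall : ∃ i, x i + 1 < z
    · obtain ⟨i, hi⟩ := hsmall
      have hi' : (x i : ℝ) + 1 + 1 ≤ z := by exact_mod_cast hi
      refine step i (x i + 1) (by omega) ?_ (by omega)
      push_cast
      nlinarith
    -- All `x i` are now z or z-1, so `t` is z(z/(z-1))^k or (z-1)((z-1)/z)^k for some k ≥ 0, which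
    -- is not strictly between z-1 and z.
    exfalso
    push Not at hbig hsmall
    set p := (Finset.univ.filter fun i => x i = z).card
    set r := (Finset.univ.filter fun i => ¬ x i = z).card
    have hpr : p + r = d := by
      simpa using Finset.card_filter_add_card_filter_not (s := Finset.univ) fun i : Fin d => x i = z
    have hprod : ∏ i, (x i : ℝ) = (z : ℝ) ^ p * ((z : ℝ) - 1) ^ r := by
      rw [← Finset.prod_filter_mul_prod_filter_not Finset.univ fun i => x i = z]
      congr 1
      · rw [Finset.prod_congr rfl fun i hi => by rw [(Finset.mem_filter.1 hi).2],
          Finset.prod_const]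
      · rw [← Finset.prod_const]
        refine Finset.prod_congr rfl fun i hi => ?_
        have h1 := (Finset.mem_filter.1 hi).2
        have h2 := hbig i
        have h3 := hsmall i
        have h4 : x i + 1 = z := by omega
        rw [← h4]
        push_cast
        ring
    rw [hprod] at hn
    clear_value p r
    have hzp : (0 : ℝ) < z := by linarith
    rcases Nat.lt_or_ge p a with hp | hp
    · obtain ⟨k, rfl⟩ := Nat.exists_eq_add_of_lt hp
      obtain rfl : r = b + k := by omega
      have e : t * ((z : ℝ) - 1) ^ k = z ^ k * z := by
        have h1 : (0 : ℝ) < (z : ℝ) ^ p * ((z : ℝ) - 1) ^ b := by positivity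
        refine mul_right_cancel₀ h1.ne' ?_
        calc _ = t * ((z : ℝ) ^ p * ((z : ℝ) - 1) ^ (b + k)) := by ring
          _ = _ := by rw [hn]; ring
      have h2 : ((z : ℝ) - 1) ^ k ≤ (z : ℝ) ^ k := pow_le_pow_left₀ hu.le (by linarith) k
      have h3 : (0 : ℝ) < ((z : ℝ) - 1) ^ k := by positivity
      nlinarith
    · obtain ⟨k, hk⟩ := Nat.exists_eq_add_of_le hp
      obtain rfl : b = r + k + 1 := by omega
      rw [hk] at hn
      have e : t * (z : ℝ) ^ k = ((z : ℝ) - 1) ^ k * (z - 1) := by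
        have h1 : (0 : ℝ) < (z : ℝ) ^ a * ((z : ℝ) - 1) ^ r := by positivity
        refine mul_right_cancel₀ h1.ne' ?_
        calc _ = t * ((z : ℝ) ^ (a + k) * ((z : ℝ) - 1) ^ r) := by ring
          _ = _ := by rw [hn]; ring
      have h2 : ((z : ℝ) - 1) ^ k ≤ (z : ℝ) ^ k := pow_le_pow_left₀ hu.le (by linarith) k
      have h3 : (0 : ℝ) < (z : ℝ) ^ k := by positivity
      nlinarith

theorem pow_mul_pow_le_mul_prod {d a b z : ℕ} (hz1 : 1 ≤ z) (hz2 : 0 < b → 2 ≤ z)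
    (hab : a + b = d + 1) {c : ℝ}
    (hc : 0 ≤ c) (x : Fin d → ℕ) (hx : ∀ i, 0 < x i) (t : ℝ) (ht : 0 < t)
    (hn : t * ∏ i, (x i : ℝ) = (z : ℝ) ^ a * ((z : ℝ) - 1) ^ b) :
    (c + z) ^ a * (c + (z - 1)) ^ b ≤ (c + t) * ∏ i, (c + (x i : ℝ)) := by
  by_cases h : 2 ≤ z
  · exact pow_mul_pow_le_mul_prod_of_two_le h hab hc x hx t ht hn
  · obtain rfl : b = 0 := by
      by_contra hb
      exact h (hz2 (by omega))
    obtain rfl : z = 1 := by omega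
    -- The factors 1 are read as z - 1 with z = 2.
    have := pow_mul_pow_le_mul_prod_of_two_le (z := 2) (a := 0) (b := a) le_rfl (by omega) hc x hx
      t ht (by rw [hn]; norm_num)
    norm_num at this ⊢
    exact this

theorem pow_mul_pow_le_card_thicken {d a b z : ℕ} (hz1 : 1 ≤ z) (hz2 : 0 < b → 2 ≤ z)
    (hab : a + b = d + 1) (c : ℕ) (A : Finset (Fin (d + 1) → ℕ))
    (hA : A.card = z ^ a * (z - 1) ^ b) :
    (c + z) ^ a * (c + (z - 1)) ^ b ≤ (thicken c A).card := by
  have hpos : 0 < A.card := by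
    rw [hA]
    rcases Nat.eq_zero_or_pos b with rfl | hb
    · simpa using Nat.pow_pos hz1
    · have := hz2 hb
      exact Nat.mul_pos (Nat.pow_pos hz1) (Nat.pow_pos (by omega))
  have h1 := envelope_card_le_card_thicken c d A (Finset.card_pos.1 hpos)
  have h2 : ((c : ℝ) + z) ^ a * (c + (z - 1)) ^ b ≤ envelope c d A.card := by
    refine le_ciInf fun x => ?_
    have hp : (0 : ℝ) < ∏ i, ((x i : ℝ) + 1) := by positivity
    have := pow_mul_pow_le_mul_prod hz1 hz2 hab (Nat.cast_nonneg (α := ℝ) c) (fun i => x i + 1)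
      (fun i => Nat.succ_pos _) (A.card / ∏ i, ((x i : ℝ) + 1))
      (div_pos (by exact_mod_cast hpos) hp) (by
        push_cast
        rw [div_mul_cancel₀ _ hp.ne', hA]
        push_cast [Nat.cast_sub hz1]
        ring)
    push_cast at this
    rw [mul_comm (∏ i, _)]
    exact this
  have h3 := h2.trans h1
  have : (((c + z) ^ a * (c + (z - 1)) ^ b : ℕ) : ℝ) ≤ ((thicken c A).card : ℝ) := by
    push_cast [Nat.cast_sub hz1]
    exact h3
  exact_mod_cast this

end ProductInequality

/-! ### Evaluation codes and the footprint bound. -/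

theorem LinearIndependent.card_le_ncard_of_support {F ι κ : Type*} [Field F] [Fintype ι]
    [Finite κ] {g : ι → κ → F} (hg : LinearIndependent F g) (T : Set κ)
    (hT : ∀ i, ∀ p ∉ T, g i p = 0) : Fintype.card ι ≤ T.ncard := by
  classical
  have := Fintype.ofFinite T
  have h : LinearIndependent F fun i => fun p : T => g i p := by
    rw [Fintype.linearIndependent_iff] at hg ⊢
    intro a ha
    refine hg a ?_
    ext p
    by_cases hp : p ∈ T
    · simpa using congrFun ha ⟨p, hp⟩
    · simp [hT _ p hp]
  have h2 := h.fintype_card_le_finrank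
  rwa [Module.finrank_fintype_fun_eq_card, Fintype.card_eq_nat_card (α := T),
    Nat.card_coe_set_eq] at h2

namespace MonomialCartesian

theorem mem_delta {m : ℕ} {F : Type*} {S : Fin m → Finset F} {M : Fin m → ℕ} :
    M ∈ delta S ↔ ∀ i, M i < (S i).card := by
  simp [delta]

theorem L₁_subset_delta {m : ℕ} {F : Type*} {S : Fin m → Finset F} {j : Fin m → ℕ} (hj : ∀ i, j i < (S i).card) :
    L₁ j ⊆ delta S := fun _ hM =>
  mem_delta.2 fun i => ((Finset.mem_Icc.1 hM).2 i).trans_lt (hj i)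

theorem D_mono {m : ℕ} {F : Type*} (S : Fin m → Finset F) {K K' : Finset (Fin m → ℕ)} (h : K ⊆ K') :
    D S K ≤ D S K' := by
  classical
  refine Finset.card_le_card fun N hN => ?_
  rw [Finset.mem_filter] at hN ⊢
  obtain ⟨h1, M, hM, h2⟩ := hN
  exact ⟨h1, M, h hM, h2⟩

variable {m : ℕ} {F : Type*} [Field F]

theorem ev_mono_apply (S : Fin m → Finset F) (M : Fin m → ℕ) (p : Point S) :
    ev S (mono F M) p = ∏ i, (p i : F) ^ M i := by
  simp [ev, mono, map_prod]

theorem ev_mono_add (S : Fin m → Finset F) (M N : Fin m → ℕ) :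
    ev S (mono F (M + N)) = ev S (mono F M) * ev S (mono F N) := by
  ext p
  simp [ev_mono_apply, pow_add, Finset.prod_mul_distrib]

theorem mono_eq_monomial (M : Fin m → ℕ) :
    mono F M = MvPolynomial.monomial (Finsupp.equivFunOnFinite.symm M) 1 := by
  rw [MvPolynomial.monomial_eq, Finsupp.prod_fintype _ _ (by simp)]
  simp [mono]

/-- A polynomial of degree less than `#(S i)` in each variable that vanishes on the whole grid is
zero. -/
theorem linearIndepOn_ev_mono (S : Fin m → Finset F) :
    LinearIndepOn F (fun M => ev S (mono F M)) (delta S : Set (Fin m → ℕ)) := by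
  classical
  rw [linearIndepOn_finset_iff]
  intro a ha M hM
  set Q : MvPolynomial (Fin m) F := ∑ N ∈ delta S, a N • mono F N
  have hcoeff : ∀ k, Q.coeff k = if Finsupp.equivFunOnFinite k ∈ delta S
      then a (Finsupp.equivFunOnFinite k) else 0 := by
    intro k
    simp only [Q, MvPolynomial.coeff_sum, MvPolynomial.coeff_smul, mono_eq_monomial,
      MvPolynomial.coeff_monomial, Equiv.symm_apply_eq, smul_eq_mul, mul_ite, mul_one, mul_zero]
    rw [Finset.sum_ite_eq']
  have hQ : Q = 0 := by
    refine MvPolynomial.eq_zero_of_eval_zero_at_prod_finset Q S (fun i => ?_) fun x hx => ?_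
    · rw [MvPolynomial.degreeOf_lt_iff ((Nat.zero_le _).trans_lt (mem_delta.1 hM i))]
      intro k hk
      rw [MvPolynomial.mem_support_iff, hcoeff] at hk
      by_cases hk' : Finsupp.equivFunOnFinite k ∈ delta S
      · exact mem_delta.1 hk' i
      · rw [if_neg hk'] at hk
        exact absurd rfl hk
    · have h : ev S Q = 0 := by simpa [Q] using ha
      exact congrFun h fun i => ⟨x i, hx i⟩
  have := hcoeff (Finsupp.equivFunOnFinite.symm M)
  rw [hQ, Equiv.apply_symm_apply, if_pos hM] at this
  simpa using this.symm

/-- The remainder of X^k modulo ∏ (X - x) over x ∈ `T`. That no exponent exceeds `k` makes reduction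
to Δ compatible with the monomial order. -/
theorem exists_pow_eq_sum (T : Finset F) (k : ℕ) : ∃ r : ℕ → F,
    (∀ l, r l ≠ 0 → l ≤ k) ∧ ∀ x ∈ T, x ^ k = ∑ l ∈ Finset.range T.card, r l * x ^ l := by
  rcases Nat.lt_or_ge k T.card with h | h
  · refine ⟨Pi.single k 1, fun l hl => ?_, fun x _ => ?_⟩
    · by_contra hlk
      exact hl (Pi.single_eq_of_ne (by omega) _)
    · simp [Pi.single_apply, h]
  · have hmonic : (Lagrange.nodal T id : Polynomial F).Monic := Lagrange.nodal_monic
    set R := (Polynomial.X ^ k : Polynomial F) %ₘ Lagrange.nodal T id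
    have hdeg : R.degree < T.card := by
      have := Polynomial.degree_modByMonic_lt (Polynomial.X ^ k : Polynomial F) hmonic
      rwa [Lagrange.degree_nodal] at this
    refine ⟨R.coeff, fun l hl => ?_, fun x hx => ?_⟩
    · by_contra hlk
      refine hl (Polynomial.coeff_eq_zero_of_degree_lt (hdeg.trans_le ?_))
      exact_mod_cast (by omega : T.card ≤ l)
    · rw [← Polynomial.eval_eq_sum_range' (by
        rcases eq_or_ne R 0 with h0 | h0
        · rw [h0, Polynomial.natDegree_zero]
          exact Finset.card_pos.2 ⟨x, hx⟩
        · exact (Polynomial.natDegree_lt_iff_degree_lt h0).2 hdeg)]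
      have h1 := congrArg (Polynomial.eval x)
        (Polynomial.modByMonic_add_div (Polynomial.X ^ k : Polynomial F) (Lagrange.nodal T id))
      have h2 : Polynomial.eval x (Lagrange.nodal T id) = 0 := Lagrange.eval_nodal_at_node (v := id) hx
      rw [Polynomial.eval_add, Polynomial.eval_mul, h2, zero_mul, add_zero, Polynomial.eval_pow,
        Polynomial.eval_X] at h1
      exact h1.symm

theorem ev_mono_mem_span_delta (S : Fin m → Finset F) (N : Fin m → ℕ) :
    ev S (mono F N) ∈
      Submodule.span F ((fun M => ev S (mono F M)) '' {M | M ∈ delta S ∧ M ≤ N}) := by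
  choose r hr1 hr2 using fun i => exists_pow_eq_sum (S i) (N i)
  have h : ev S (mono F N) = ∑ M ∈ delta S, (∏ i, r i (M i)) • ev S (mono F M) := by
    ext p
    rw [ev_mono_apply, Finset.prod_congr rfl fun i _ => hr2 i (p i) (p i).2,
      Finset.prod_univ_sum, Finset.sum_apply]
    refine Finset.sum_congr rfl fun M _ => ?_
    rw [Pi.smul_apply, ev_mono_apply, Finset.prod_mul_distrib, smul_eq_mul]
  rw [h]
  refine Submodule.sum_mem _ fun M hM => ?_
  by_cases h0 : ∏ i, r i (M i) = 0
  · rw [h0, zero_smul]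
    exact Submodule.zero_mem _
  · refine Submodule.smul_mem _ _ (Submodule.subset_span ⟨M, ⟨hM, fun i => ?_⟩, rfl⟩)
    exact hr1 i _ (Finset.prod_ne_zero_iff.1 h0 i (Finset.mem_univ i))

theorem code_eq_span (S : Fin m → Finset F) (L : Finset (Fin m → ℕ)) :
    code S L = Submodule.span F ((fun M => ev S (mono F M)) '' (L : Set (Fin m → ℕ))) := by
  rw [code, Submodule.map_span, Set.image_image]

theorem mem_code {S : Fin m → Finset F} {L : Finset (Fin m → ℕ)} {w : Point S → F} :
    w ∈ code S L ↔ ∃ C : (Fin m → ℕ) → F, ∑ M ∈ L, C M • ev S (mono F M) = w := by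
  classical
  rw [code_eq_span, Submodule.mem_span_image_finset_iff_exists_fun]
  constructor
  · rintro ⟨C, rfl⟩
    refine ⟨fun M => if h : M ∈ L then C ⟨M, h⟩ else 0, ?_⟩
    rw [← Finset.sum_coe_sort]
    exact Finset.sum_congr rfl fun M _ => by simp
  · rintro ⟨C, rfl⟩
    exact ⟨fun M => C M, Finset.sum_coe_sort L fun M => C M • ev S (mono F M)⟩

theorem finrank_code {S : Fin m → Finset F} {L : Finset (Fin m → ℕ)} (hL : L ⊆ delta S) :
    Module.finrank F (code S L) = L.card := by
  have h : LinearIndepOn F (fun M => ev S (mono F M)) (L : Set (Fin m → ℕ)) :=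
    (linearIndepOn_ev_mono S).mono hL
  rw [code_eq_span, Set.image_eq_range, finrank_span_eq_card h]
  simp

/-- The span of the evaluations of the monomials that are lexicographically below `N`. -/
noncomputable def lowerSpan (S : Fin m → Finset F) (N : Fin m → ℕ) : Submodule F (Point S → F) :=
  Submodule.span F ((fun M => ev S (mono F M)) '' {M | toLex M < toLex N})

theorem ev_mono_mem_lowerSpan {S : Fin m → Finset F} {M N : Fin m → ℕ} (h : toLex M < toLex N) :
    ev S (mono F M) ∈ lowerSpan S N :=
  Submodule.subset_span ⟨M, h, rfl⟩

theorem lowerSpan_mono (S : Fin m → Finset F) {M N : Fin m → ℕ} (h : toLex M < toLex N) :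
    lowerSpan S M ≤ lowerSpan S N :=
  Submodule.span_mono (Set.image_mono fun _ hK => lt_trans hK h)

/-- `lowerSpan` also admits monomials outside Δ, but reducing these only lowers exponents, so
independence within Δ suffices. -/
theorem ev_mono_notMem_lowerSpan {S : Fin m → Finset F} {N : Fin m → ℕ} (hN : N ∈ delta S) :
    ev S (mono F N) ∉ lowerSpan S N := by
  intro h
  have hle : lowerSpan S N ≤ Submodule.span F
      ((fun M => ev S (mono F M)) '' {M | M ∈ delta S ∧ toLex M < toLex N}) := by
    refine Submodule.span_le.2 ?_
    rintro _ ⟨M, hM, rfl⟩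
    refine Submodule.span_mono (Set.image_mono ?_) (ev_mono_mem_span_delta S M)
    exact fun K hK => ⟨hK.1, (Pi.toLex_monotone hK.2).trans_lt hM⟩
  refine (linearIndepOn_ev_mono S).notMem_span hN (Submodule.span_mono (Set.image_mono ?_) (hle h))
  rintro M ⟨hM, hlt⟩
  refine ⟨hM, ?_⟩
  rintro rfl
  exact lt_irrefl _ hlt

theorem linearIndependent_of_leading {S : Fin m → Finset F} {E : Finset (Fin m → ℕ)}
    (hE : E ⊆ delta S) (g : E → Point S → F)
    (hg : ∀ N : E, ∃ a : F, a ≠ 0 ∧ g N - a • ev S (mono F (N : Fin m → ℕ)) ∈ lowerSpan S N) :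
    LinearIndependent F g := by
  classical
  choose α hα0 hα using hg
  rw [Fintype.linearIndependent_iff]
  intro b hb
  by_contra hne
  push Not at hne
  obtain ⟨N₁, hN₁⟩ := hne
  obtain ⟨N, hN, hmax⟩ := (Finset.univ.filter fun N : E => b N ≠ 0).exists_max_image
    (fun N => toLex (N : Fin m → ℕ)) ⟨N₁, by simpa using hN₁⟩
  have hbN : b N ≠ 0 := (Finset.mem_filter.1 hN).2
  have hrest : ∑ M ∈ Finset.univ.erase N, b M • g M ∈ lowerSpan S (N : Fin m → ℕ) := by
    refine Submodule.sum_mem _ fun M hM => ?_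
    by_cases hbM : b M = 0
    · rw [hbM, zero_smul]
      exact Submodule.zero_mem _
    · have hlt : toLex (M : Fin m → ℕ) < toLex (N : Fin m → ℕ) := by
        refine lt_of_le_of_ne (hmax M (by simpa using hbM)) fun h => ?_
        exact Finset.ne_of_mem_erase hM (Subtype.ext (toLex.injective h))
      refine Submodule.smul_mem _ _ ?_
      have := Submodule.add_mem _ (lowerSpan_mono S hlt (hα M))
        (Submodule.smul_mem _ (α M) (ev_mono_mem_lowerSpan (S := S) hlt))
      rwa [sub_add_cancel] at this
  rw [← Finset.add_sum_erase _ _ (Finset.mem_univ N)] at hb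
  have h1 : b N • g N ∈ lowerSpan S (N : Fin m → ℕ) := by
    rw [eq_neg_of_add_eq_zero_left hb]
    exact Submodule.neg_mem _ hrest
  have h2 : g N ∈ lowerSpan S (N : Fin m → ℕ) := (Submodule.smul_mem_iff _ hbN).1 h1
  have h3 := Submodule.sub_mem _ h2 (hα N)
  rw [sub_sub_cancel, Submodule.smul_mem_iff _ (hα0 N)] at h3
  exact ev_mono_notMem_lowerSpan (hE N.2) h3

theorem coeff_eq_zero_of_sum_mem_code {S : Fin m → Finset F} {v j : Fin m → ℕ}
    (hj : ∀ i, j i < (S i).card) {C : (Fin m → ℕ) → F}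
    (hC : ∑ M ∈ L₁ j, C M • ev S (mono F M) ∈ code S (L₂ v j)) {M : Fin m → ℕ}
    (hM : M ∈ box v j) : C M = 0 := by
  obtain ⟨B, hB⟩ := mem_code.1 hC
  have hinter : L₁ j ∩ L₂ v j = L₂ v j := Finset.inter_eq_right.2 Finset.sdiff_subset
  have hind := linearIndepOn_finset_iff.1
    ((linearIndepOn_ev_mono S).mono (t := (L₁ j : Set (Fin m → ℕ))) (L₁_subset_delta hj))
    (fun M => C M - if M ∈ L₂ v j then B M else 0) (by
      simp only [sub_smul, Finset.sum_sub_distrib, ← hB, ite_smul, zero_smul]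
      rw [← Finset.sum_filter, Finset.filter_mem_eq_inter, hinter, sub_self])
  have hM1 : M ∈ L₁ j := Finset.mem_Icc.2 ⟨zero_le, (Finset.mem_Icc.1 hM).2⟩
  have := hind M hM1
  simpa [L₂, hM] using this

/-- The footprint bound. -/
theorem exists_subset_diamond_D_le {S : Fin m → Finset F} {v j : Fin m → ℕ}
    (hj : ∀ i, j i < (S i).card) {W : Submodule F (Point S → F)} (hW1 : W ≤ code S (L₁ j))
    (hW2 : W ⊓ code S (L₂ v j) = ⊥) :
    ∃ K ⊆ diamond v j, K.card = Module.finrank F W ∧ D S K ≤ (codeSupport W).ncard := by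
  classical
  have hind : LinearIndependent F fun M : L₁ j => ev S (mono F (M : Fin m → ℕ)) :=
    (linearIndepOn_ev_mono S).mono (t := (L₁ j : Set (Fin m → ℕ))) (L₁_subset_delta hj)
  set Φ := Fintype.linearCombination F fun M : L₁ j => ev S (mono F (M : Fin m → ℕ))
  have hΦ : ∀ C, Φ C = ∑ M : L₁ j, C M • ev S (mono F (M : Fin m → ℕ)) := fun C =>
    Fintype.linearCombination_apply _ _ _
  have hΦ0 : ∀ C, Φ C = 0 → C = 0 := fun C hC =>
    funext (Fintype.linearIndependent_iff.1 hind C (by rwa [hΦ] at hC))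
  set W' := W.comap Φ
  have hmap : W'.map Φ = W := by
    refine Submodule.map_comap_eq_self fun w hw => ?_
    obtain ⟨C, rfl⟩ := mem_code.1 (hW1 hw)
    refine ⟨fun M => C M, ?_⟩
    rw [hΦ]
    exact Finset.sum_coe_sort (L₁ j) fun M => C M • ev S (mono F M)
  let IsLead (C : L₁ j → F) (M : L₁ j) : Prop :=
    C M ≠ 0 ∧ ∀ M' : L₁ j, C M' ≠ 0 → toLex (M' : Fin m → ℕ) ≤ toLex (M : Fin m → ℕ)
  have exists_lead : ∀ C, C ≠ 0 → ∃ M, IsLead C M := by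
    intro C hC
    obtain ⟨M₁, hM₁⟩ := Function.ne_iff.1 hC
    obtain ⟨M, hM, hmax⟩ := (Finset.univ.filter fun M : L₁ j => C M ≠ 0).exists_max_image
      (fun M => toLex (M : Fin m → ℕ)) ⟨M₁, by simpa using hM₁⟩
    exact ⟨M, (Finset.mem_filter.1 hM).2, fun M' hM' => hmax M' (by simpa using hM')⟩
  set K : Finset (L₁ j) := Finset.univ.filter fun M => ∃ C ∈ W', IsLead C M
  have hK : ∀ M, M ∈ K ↔ ∃ C ∈ W', IsLead C M := fun M => by simp [K]
  set K' : Finset (Fin m → ℕ) := K.map (Function.Embedding.subtype _)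
  -- A word whose leading monomial precedes `v` involves no monomial of the box, so it lies in
  -- C(L₂), which meets `W` trivially.
  have hdiamond : K' ⊆ diamond v j := by
    intro N hN
    obtain ⟨M, hM, rfl⟩ := Finset.mem_map.1 hN
    obtain ⟨C, hC, hC0, hmax⟩ := (hK M).1 hM
    refine Finset.mem_filter.2 ⟨M.2, ?_⟩
    by_contra hlt
    refine hC0 ?_
    suffices h : Φ C ∈ W ⊓ code S (L₂ v j) by
      rw [hW2, Submodule.mem_bot] at h
      exact congrFun (hΦ0 C h) M
    refine ⟨hC, ?_⟩
    rw [hΦ]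
    refine Submodule.sum_mem _ fun M' _ => ?_
    by_cases hM' : C M' = 0
    · rw [hM', zero_smul]
      exact Submodule.zero_mem _
    · refine Submodule.smul_mem _ _ ?_
      rw [code_eq_span]
      refine Submodule.subset_span ⟨M', Finset.mem_sdiff.2 ⟨M'.2, fun hbox => hlt ?_⟩, rfl⟩
      exact (Pi.toLex_monotone (Finset.mem_Icc.1 hbox).1).trans (hmax M' hM')
  -- The coefficients at the leading positions determine a word of `W'`: a nonzero one has a nonzero
  -- coefficient at its own leading position.
  have hcard : Module.finrank F W ≤ K'.card := by
    rw [← hmap]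
    refine (Submodule.finrank_map_le _ _).trans ?_
    have hinj : Function.Injective
        ((LinearMap.funLeft F F (fun M : K => (M : L₁ j))).comp W'.subtype) := by
      rw [← LinearMap.ker_eq_bot, LinearMap.ker_eq_bot']
      rintro ⟨C, hC⟩ h0
      by_contra hne
      obtain ⟨M, hM⟩ := exists_lead C fun h => hne (Subtype.ext h)
      exact hM.1 (congrFun h0 ⟨M, (hK M).2 ⟨C, hC, hM⟩⟩)
    have := LinearMap.finrank_le_finrank_of_injective hinj
    rwa [Module.finrank_fintype_fun_eq_card, Fintype.card_coe, ← Finset.card_map] at this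
  -- A multiple `N` of a leading monomial `M` is the leading monomial of N/M times a word of `W`.
  -- These products are independent and vanish off the support of `W`.
  have hD : D S K' ≤ (codeSupport W).ncard := by
    have hex : ∀ N : ((delta S).filter fun N => ∃ M ∈ K', M ≤ N), ∃ g : Point S → F,
        (∀ p ∉ codeSupport W, g p = 0) ∧
        ∃ a : F, a ≠ 0 ∧ g - a • ev S (mono F (N : Fin m → ℕ)) ∈ lowerSpan S N := by
      rintro ⟨N, hN⟩
      obtain ⟨hN, M', hM', hle⟩ := Finset.mem_filter.1 hN
      obtain ⟨M, hM, rfl⟩ := Finset.mem_map.1 hM'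
      obtain ⟨C, hC, hC0, hmax⟩ := (hK M).1 hM
      have hsub : N - M + M = N := tsub_add_cancel_of_le hle
      refine ⟨ev S (mono F (N - M)) * Φ C, fun p hp => ?_, C M, hC0, ?_⟩
      · have : Φ C p = 0 := by
          by_contra h
          exact hp ⟨Φ C, hC, h⟩
        rw [Pi.mul_apply, this, mul_zero]
      · have hsum : ev S (mono F (N - M)) * Φ C
            = ∑ M' : L₁ j, C M' • ev S (mono F (N - M + M')) := by
          rw [hΦ, Finset.mul_sum]
          exact Finset.sum_congr rfl fun M' _ => by rw [mul_smul_comm, ev_mono_add]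
        rw [hsum, ← Finset.add_sum_erase _ _ (Finset.mem_univ M), hsub, add_sub_cancel_left]
        refine Submodule.sum_mem _ fun M' hM' => ?_
        by_cases hCM' : C M' = 0
        · rw [hCM', zero_smul]
          exact Submodule.zero_mem _
        · refine Submodule.smul_mem _ _ (ev_mono_mem_lowerSpan ?_)
          have hlt : toLex (M' : Fin m → ℕ) < toLex (M : Fin m → ℕ) :=
            lt_of_le_of_ne (hmax M' hCM') fun h =>
              Finset.ne_of_mem_erase hM' (Subtype.ext (toLex.injective h))
          have := add_lt_add_right hlt (toLex (N - M))
          rwa [← toLex_add, ← toLex_add, hsub] at this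
    choose g hg1 hg2 using hex
    have := (linearIndependent_of_leading (Finset.filter_subset _ _) g hg2).card_le_ncard_of_support
      (codeSupport W) hg1
    rwa [Fintype.card_coe] at this
  obtain ⟨K₀, hK₀, hK₀'⟩ := Finset.exists_subset_card_eq hcard
  exact ⟨K₀, hK₀.trans hdiamond, hK₀', (D_mono S hK₀).trans hD⟩

end MonomialCartesian

/-! ### Information in the scheme as a dimension. -/

namespace CosetScheme

variable {F ι : Type*} [Field F] {C₂ C₁ : Submodule F (ι → F)}

theorem encode_eq (P : CosetScheme C₂ C₁) (a : Fin P.k₂ → F) (x : Fin P.ℓ → F) :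
    P.encode a x = (P.basis₁.equivFun.symm (Sum.elim a x) : C₁) := by
  simp [encode, Module.Basis.equivFun_symm_apply, Fintype.sum_sum_type]

/-- The secret that is encoded in a word of `C₁`. -/
noncomputable def decode (P : CosetScheme C₂ C₁) : C₁ →ₗ[F] (Fin P.ℓ → F) :=
  (LinearMap.funLeft F F Sum.inr).comp P.basis₁.equivFun.toLinearMap

theorem exists_encode_eq (P : CosetScheme C₂ C₁) (c : C₁) :
    ∃ a, P.encode a (P.decode c) = (c : ι → F) := by
  refine ⟨fun i => P.basis₁.equivFun c (Sum.inl i), ?_⟩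
  rw [encode_eq]
  congr 1
  rw [LinearEquiv.symm_apply_eq]
  ext i
  rcases i with i | i <;> rfl

theorem decode_encode (P : CosetScheme C₂ C₁) (a : Fin P.k₂ → F) (x : Fin P.ℓ → F) :
    P.decode (P.basis₁.equivFun.symm (Sum.elim a x)) = x := by
  simp only [decode, LinearMap.comp_apply, LinearEquiv.coe_coe, LinearEquiv.apply_symm_apply]
  rfl

theorem decode_eq_zero_iff (P : CosetScheme C₂ C₁) (c : C₁) :
    P.decode c = 0 ↔ (c : ι → F) ∈ C₂ := by
  constructor
  · intro h
    obtain ⟨a, ha⟩ := P.exists_encode_eq c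
    rw [h] at ha
    rw [← ha]
    simp only [encode, Pi.zero_apply, zero_smul, Finset.sum_const_zero, add_zero, P.basis₁_inl]
    exact Submodule.sum_mem _ fun i _ => Submodule.smul_mem _ _ (P.basis₂ i).2
  · intro h
    have h1 : P.encode (P.basis₂.equivFun ⟨c, h⟩) 0 = (c : ι → F) := by
      simp only [encode, Pi.zero_apply, zero_smul, Finset.sum_const_zero, add_zero, P.basis₁_inl]
      have := congrArg (Subtype.val) (P.basis₂.sum_equivFun ⟨c, h⟩)
      simpa only [Submodule.coe_sum, Submodule.coe_smul] using this
    rw [encode_eq] at h1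
    rw [← Subtype.ext h1, decode_encode]

/-- The secrets of the words that vanish on `A`. -/
noncomputable def hiddenSecrets (P : CosetScheme C₂ C₁) (A : Finset ι) :
    Submodule F (Fin P.ℓ → F) :=
  (Submodule.comap C₁.subtype
    (⨅ p ∈ A, LinearMap.ker (LinearMap.proj p : (ι → F) →ₗ[F] F))).map P.decode

theorem mem_hiddenSecrets {P : CosetScheme C₂ C₁} {A : Finset ι} {x : Fin P.ℓ → F} :
    x ∈ P.hiddenSecrets A ↔ ∃ c : C₁, (∀ p ∈ A, (c : ι → F) p = 0) ∧ P.decode c = x := by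
  simp [hiddenSecrets, Submodule.mem_map, Submodule.mem_iInf]

theorem mem_possibleSecrets {P : CosetScheme C₂ C₁} {A : Finset ι} {a : Fin P.k₂ → F}
    {x y : Fin P.ℓ → F} :
    y ∈ P.possibleSecrets A (P.encode a x) ↔ y - x ∈ P.hiddenSecrets A := by
  rw [mem_hiddenSecrets, possibleSecrets, Set.mem_ofPred_eq]
  constructor
  · rintro ⟨b, hb⟩
    refine ⟨P.basis₁.equivFun.symm (Sum.elim b y) - P.basis₁.equivFun.symm (Sum.elim a x),
      fun p hp => ?_, ?_⟩
    · have := hb p hp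
      rw [encode_eq, encode_eq] at this
      simpa [sub_eq_zero] using this
    · rw [map_sub, decode_encode, decode_encode]
  · rintro ⟨c, hc, hcy⟩
    obtain ⟨b, hb⟩ := P.exists_encode_eq (c + P.basis₁.equivFun.symm (Sum.elim a x))
    rw [map_add, decode_encode, hcy, sub_add_cancel] at hb
    refine ⟨b, fun p hp => ?_⟩
    rw [hb, encode_eq]
    simpa using hc p hp

/-- The compatible secrets form a coset of `hiddenSecrets`, so the information does not depend on
which share vector was dealt. -/
theorem information_encode [Fintype F] (P : CosetScheme C₂ C₁) (A : Finset ι)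
    (a : Fin P.k₂ → F) (x : Fin P.ℓ → F) :
    P.information A (P.encode a x) = P.ℓ - Module.finrank F (P.hiddenSecrets A) := by
  have h : (P.possibleSecrets A (P.encode a x)).ncard
      = Fintype.card F ^ Module.finrank F (P.hiddenSecrets A) := by
    have h1 : P.possibleSecrets A (P.encode a x)
        = (fun y => y + x) '' (P.hiddenSecrets A : Set (Fin P.ℓ → F)) := by
      ext y
      rw [mem_possibleSecrets, Set.mem_image]
      exact ⟨fun h => ⟨_, h, sub_add_cancel _ _⟩, by rintro ⟨z, hz, rfl⟩; simpa using hz⟩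
    rw [h1, Set.ncard_image_of_injective _ (add_left_injective x), ← Nat.card_coe_set_eq,
      ← Nat.card_eq_fintype_card (α := F)]
    exact Module.natCard_eq_pow_finrank (K := F)
  have hq : (1 : ℝ) < Fintype.card F := by exact_mod_cast Fintype.one_lt_card
  rw [information, h, Nat.cast_pow, Real.logb_pow, Real.logb_self_eq_one hq, mul_one]

theorem nonQualifying_iff [Fintype F] (P : CosetScheme C₂ C₁) (A : Finset ι) {e : ℕ}
    (he : e ≤ P.ℓ) :
    P.NonQualifying (P.ℓ - e + 1) A ↔ e ≤ Module.finrank F (P.hiddenSecrets A) := by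
  have : P.CanRecover A (P.ℓ - e + 1) ↔ Module.finrank F (P.hiddenSecrets A) < e := by
    simp only [CanRecover, information_encode, forall_const]
    push_cast [Nat.cast_sub he]
    rw [← Nat.succ_le_iff, ← Nat.cast_le (α := ℝ)]
    push_cast
    constructor <;> intro h <;> linarith
  rw [NonQualifying, this, not_lt]

theorem hiddenSecrets_anti (P : CosetScheme C₂ C₁) {A B : Finset ι} (h : A ⊆ B) :
    P.hiddenSecrets B ≤ P.hiddenSecrets A := by
  intro x hx
  obtain ⟨c, hc, hcx⟩ := mem_hiddenSecrets.1 hx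
  exact mem_hiddenSecrets.2 ⟨c, fun p hp => hc p (h hp), hcx⟩

theorem finrank_le_finrank_hiddenSecrets (P : CosetScheme C₂ C₁) (A : Finset ι)
    {W : Submodule F (ι → F)} (hW1 : W ≤ C₁) (hW2 : W ⊓ C₂ = ⊥)
    (hA : ∀ c ∈ W, ∀ p ∈ A, c p = 0) :
    Module.finrank F W ≤ Module.finrank F (P.hiddenSecrets A) := by
  let f : W →ₗ[F] P.hiddenSecrets A :=
    (P.decode.comp (Submodule.inclusion hW1)).codRestrict _ fun c =>
      mem_hiddenSecrets.2 ⟨_, hA c c.2, rfl⟩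
  refine LinearMap.finrank_le_finrank_of_injective (f := f) ?_
  rw [← LinearMap.ker_eq_bot, LinearMap.ker_eq_bot']
  intro c hc
  have h1 : P.decode (Submodule.inclusion hW1 c) = 0 := congrArg Subtype.val hc
  rw [decode_eq_zero_iff] at h1
  have h2 : (c : ι → F) ∈ W ⊓ C₂ := ⟨c.2, h1⟩
  rw [hW2, Submodule.mem_bot] at h2
  exact Subtype.ext h2

/-- Independent hidden secrets are lifted to words vanishing on `A`; `decode` is injective on their
span and has kernel C₂. -/
theorem exists_submodule_of_le_finrank_hiddenSecrets (P : CosetScheme C₂ C₁) (A : Finset ι)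
    {e : ℕ} (he : e ≤ Module.finrank F (P.hiddenSecrets A)) :
    ∃ W : Submodule F (ι → F), W ≤ C₁ ∧ W ⊓ C₂ = ⊥ ∧ Module.finrank F W = e ∧
      ∀ c ∈ W, ∀ p ∈ A, c p = 0 := by
  obtain ⟨b, hb⟩ := exists_linearIndependent_of_le_finrank he
  choose w hw0 hw using fun i => mem_hiddenSecrets.1 (b i).2
  have hdec : LinearIndependent F fun i => P.decode (w i) := by
    simp only [hw]
    exact hb.map' (P.hiddenSecrets A).subtype (Submodule.ker_subtype _)
  have hind : LinearIndependent F fun i => (w i : ι → F) :=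
    (LinearIndependent.of_comp P.decode hdec).map' C₁.subtype (Submodule.ker_subtype _)
  refine ⟨Submodule.span F (Set.range fun i => (w i : ι → F)), ?_, ?_, ?_, ?_⟩
  · rw [Submodule.span_le]
    rintro _ ⟨i, rfl⟩
    exact (w i).2
  · rw [Submodule.eq_bot_iff]
    rintro c ⟨hc, hc2⟩
    obtain ⟨t, rfl⟩ := (Submodule.mem_span_range_iff_exists_fun F).1 hc
    have h1 : P.decode (∑ i, t i • w i) = 0 := by
      rw [decode_eq_zero_iff]
      simpa using hc2
    simp only [map_sum, map_smul] at h1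
    have := Fintype.linearIndependent_iff.1 hdec t h1
    simp [this]
  · rw [finrank_span_eq_card hind, Fintype.card_fin]
  · intro c hc p hp
    obtain ⟨t, rfl⟩ := (Submodule.mem_span_range_iff_exists_fun F).1 hc
    simp [hw0 _ p hp]

theorem finrank_eq_add (P : CosetScheme C₂ C₁) :
    Module.finrank F C₁ = Module.finrank F C₂ + P.ℓ := by
  rw [Module.finrank_eq_card_basis P.basis₁, Module.finrank_eq_card_basis P.basis₂]
  simp

end CosetScheme

/-! ### Spaces of words supported on a product set. -/

namespace MonomialCartesian

theorem card_thicken_le_D {m : ℕ} {F : Type*} (S : Fin m → Finset F) {v j : Fin m → ℕ} {c : ℕ}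
    (hc : ∀ i, j i + c < (S i).card) {K : Finset (Fin m → ℕ)} (hK : K ⊆ box v j) :
    (thicken c K).card ≤ D S K := by
  classical
  refine Finset.card_le_card fun N hN => ?_
  obtain ⟨M, hM, h⟩ := mem_thicken.1 hN
  refine Finset.mem_filter.2 ⟨mem_delta.2 fun i => ?_, M, hM, fun i => (h i).1⟩
  have h1 : M i ≤ j i := (Finset.mem_Icc.1 (hK hM)).2 i
  have h2 := h i
  have h3 := hc i
  omega

theorem ncard_setOf_forall_mem {m : ℕ} {F : Type*} {S T : Fin m → Finset F} (hT : ∀ i, T i ⊆ S i) :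
    {p : Point S | ∀ i, (p i : F) ∈ T i}.ncard = ∏ i, (T i).card := by
  classical
  have h : {p : Point S | ∀ i, (p i : F) ∈ T i}
      = (Fintype.piFinset fun i => (T i).subtype (· ∈ S i) : Finset (Point S)) := by
    ext p
    simp
  rw [h, Set.ncard_coe_finset, Fintype.card_piFinset]
  refine Finset.prod_congr rfl fun i _ => ?_
  rw [Finset.card_subtype, Finset.filter_true_of_mem (hT i)]

theorem card_removeProduct {m : ℕ} {F : Type*} {S T : Fin m → Finset F} (hT : ∀ i, T i ⊆ S i) :
    (removeProduct S T).card = Fintype.card (Point S) - ∏ i, (T i).card := by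
  classical
  rw [removeProduct, Finset.filter_not, Finset.card_sdiff_of_subset (Finset.filter_subset _ _),
    Finset.card_univ, ← ncard_setOf_forall_mem hT, ← Set.ncard_coe_finset]
  simp

variable {m : ℕ} {F : Type*} [Field F]

theorem L₁_eq_piFinset (j : Fin m → ℕ) :
    L₁ j = Fintype.piFinset fun i => Finset.range (j i + 1) := by
  ext M
  simp [L₁, Pi.le_def]

theorem sum_prod_coeff_smul_ev_mono (S : Fin m → Finset F) {j : Fin m → ℕ}
    (h : Fin m → Polynomial F) (hdeg : ∀ i, (h i).natDegree ≤ j i) (p : Point S) :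
    (∑ M ∈ L₁ j, (∏ i, (h i).coeff (M i)) • ev S (mono F M)) p =
      ∏ i, (h i).eval (p i : F) := by
  rw [Finset.prod_congr rfl fun i _ =>
    Polynomial.eval_eq_sum_range' (Nat.lt_succ_of_le (hdeg i)) (p i : F), Finset.prod_univ_sum,
    Finset.sum_apply, L₁_eq_piFinset]
  refine Finset.sum_congr rfl fun M _ => ?_
  rw [Pi.smul_apply, ev_mono_apply, Finset.prod_mul_distrib, smul_eq_mul]

/-- `W` is spanned by the words of ∏ Q_i(X_i) X_i^{k_i} with k_i < u_i, where Q_i has the simple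
roots S_i \ T_i. Their leading exponents fill the corner of the box below `j` with sides `u`. -/
theorem exists_submodule_codeSupport_eq {S T : Fin m → Finset F} {v j u : Fin m → ℕ}
    (hj : ∀ i, j i < (S i).card) (hT : ∀ i, T i ⊆ S i) (hu : ∀ i, 1 ≤ u i)
    (hcard : ∀ i, (T i).card + j i + 1 = (S i).card + u i) (hv : ∀ i, v i + u i ≤ j i + 1) :
    ∃ W : Submodule F (Point S → F), W ≤ code S (L₁ j) ∧ W ⊓ code S (L₂ v j) = ⊥ ∧
      Module.finrank F W = ∏ i, u i ∧ codeSupport W = {p | ∀ i, (p i : F) ∈ T i} := by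
  classical
  set Q : Fin m → Polynomial F := fun i => Lagrange.nodal (S i \ T i) id
  -- By `hcard` this is the number of points of S_i \ T_i.
  set d : Fin m → ℕ := fun i => j i + 1 - u i
  have hQdeg : ∀ i, (Q i).natDegree = d i := by
    intro i
    have h1 := Finset.card_sdiff_add_card_eq_card (hT i)
    have h2 := hcard i
    rw [Lagrange.natDegree_nodal]
    simp only [d]
    omega
  have hQlead : ∀ i, (Q i).coeff (d i) = 1 := fun i => by
    rw [← hQdeg]
    exact Lagrange.nodal_monic
  have hQeval : ∀ i (x : F), x ∈ S i → ((Q i).eval x ≠ 0 ↔ x ∈ T i) := by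
    intro i x hx
    rw [Lagrange.eval_nodal, Finset.prod_ne_zero_iff]
    constructor
    · intro h
      by_contra hxT
      exact h x (Finset.mem_sdiff.2 ⟨hx, hxT⟩) (sub_self x)
    · intro hxT y hy hxy
      rw [id, sub_eq_zero] at hxy
      exact (Finset.mem_sdiff.1 hy).2 (hxy ▸ hxT)
  set E : Finset (Fin m → ℕ) := Fintype.piFinset fun i => Finset.range (u i)
  have hE : ∀ k, k ∈ E ↔ ∀ i, k i < u i := fun k => by simp [E]
  set A : (Fin m → ℕ) → (Fin m → ℕ) → F := fun k M => ∏ i, (Q i * Polynomial.X ^ k i).coeff (M i)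
  have hdegle : ∀ k ∈ E, ∀ i, (Q i * Polynomial.X ^ k i).natDegree ≤ j i := by
    intro k hk i
    have h1 := (hE k).1 hk i
    have h2 := hv i
    rw [Polynomial.natDegree_mul_X_pow _ (Lagrange.nodal_ne_zero), hQdeg]
    simp only [d]
    omega
  set w : E → Point S → F := fun k => ∑ M ∈ L₁ j, A k M • ev S (mono F M)
  have hw : ∀ (k : E) p, w k p = ∏ i, ((Q i).eval (p i : F) * (p i : F) ^ (k : Fin m → ℕ) i) := by
    intro k p
    have := sum_prod_coeff_smul_ev_mono S (fun i => Q i * Polynomial.X ^ (k : Fin m → ℕ) i)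
      (hdegle k k.2) p
    simpa only [Polynomial.eval_mul, Polynomial.eval_pow, Polynomial.eval_X] using this
  -- Together with `hA0`: the coefficients at the monomials `d + k` form a unitriangular matrix.
  have hA1 : ∀ k, A k (d + k) = 1 := by
    intro k
    refine Finset.prod_eq_one fun i _ => ?_
    rw [Pi.add_apply, Polynomial.coeff_mul_X_pow]
    exact hQlead i
  have hA0 : ∀ k l, A l (d + k) ≠ 0 → k ≤ l := by
    intro k l h i
    have h1 := Polynomial.le_natDegree_of_ne_zero (Finset.prod_ne_zero_iff.1 h i (Finset.mem_univ i))
    rw [Polynomial.natDegree_mul_X_pow _ (Lagrange.nodal_ne_zero), hQdeg, Pi.add_apply] at h1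
    exact Nat.le_of_add_le_add_left h1
  have key : ∀ a : E → F, ∑ k, a k • w k ∈ code S (L₂ v j) → ∀ k, a k = 0 := by
    intro a ha
    have hsum : ∑ k, a k • w k
        = ∑ M ∈ L₁ j, (∑ k : E, a k * A k M) • ev S (mono F M) := by
      simp only [w, Finset.smul_sum, Finset.sum_smul, smul_smul]
      exact Finset.sum_comm
    rw [hsum] at ha
    by_contra hne
    push Not at hne
    obtain ⟨k₁, hk₁⟩ := hne
    obtain ⟨k, hk, hmax⟩ := (Finset.univ.filter fun k : E => a k ≠ 0).exists_max_image
      (fun k => toLex (k : Fin m → ℕ)) ⟨k₁, by simpa using hk₁⟩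
    -- For the lexicographically largest `k` with `a k ≠ 0`, the coefficient at `d + k` is `a k`
    -- itself, while membership in C(L₂) forces it to vanish.
    have hbox : d + (k : Fin m → ℕ) ∈ box v j := by
      refine Finset.mem_Icc.2 ⟨fun i => ?_, fun i => ?_⟩ <;>
      · have h1 := (hE k).1 k.2 i
        have h2 := hv i
        simp only [d, Pi.add_apply]
        omega
    have h0 := coeff_eq_zero_of_sum_mem_code hj ha hbox
    rw [Finset.sum_eq_single k, hA1, mul_one] at h0
    · exact (Finset.mem_filter.1 hk).2 h0
    · intro l _ hlk
      by_contra hl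
      have h1 := hmax l (by simpa using left_ne_zero_of_mul hl)
      have h2 := Pi.toLex_monotone (hA0 _ _ (right_ne_zero_of_mul hl))
      exact hlk (Subtype.ext (toLex.injective (le_antisymm h1 h2)))
    · intro h
      exact absurd (Finset.mem_univ k) h
  have hind : LinearIndependent F w := by
    rw [Fintype.linearIndependent_iff]
    intro a ha
    exact key a (ha ▸ Submodule.zero_mem _)
  refine ⟨Submodule.span F (Set.range w), ?_, ?_, ?_, ?_⟩
  · rw [Submodule.span_le]
    rintro _ ⟨k, rfl⟩
    exact mem_code.2 ⟨A k, rfl⟩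
  · rw [Submodule.eq_bot_iff]
    rintro c ⟨hc, hc2⟩
    obtain ⟨a, rfl⟩ := (Submodule.mem_span_range_iff_exists_fun F).1 hc
    simp [key a hc2]
  · rw [finrank_span_eq_card hind, Fintype.card_coe, Fintype.card_piFinset]
    simp
  · ext p
    constructor
    · rintro ⟨c, hc, hcp⟩ i
      by_contra hpi
      obtain ⟨a, rfl⟩ := (Submodule.mem_span_range_iff_exists_fun F).1 hc
      refine hcp ?_
      rw [Finset.sum_apply]
      refine Finset.sum_eq_zero fun k _ => ?_
      have h0 : (Q i).eval (p i : F) = 0 := by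
        by_contra h
        exact hpi ((hQeval i _ (p i).2).1 h)
      rw [Pi.smul_apply, hw, Finset.prod_eq_zero (Finset.mem_univ i) (by rw [h0, zero_mul]),
        smul_zero]
    · intro hp
      have h0 : (0 : Fin m → ℕ) ∈ E := (hE 0).2 fun i => hu i
      refine ⟨w ⟨0, h0⟩, Submodule.subset_span ⟨_, rfl⟩, ?_⟩
      rw [hw, Finset.prod_ne_zero_iff]
      intro i _
      simpa using (hQeval i _ (p i).2).2 (hp i)

end MonomialCartesian

/-! ### The relative weight and the maximum non-qualifying sets. -/

namespace MonomialCartesian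

variable {m : ℕ} {F : Type*} [Field F]

theorem prod_ite_mem_eq_pow_mul_pow {a b : ℕ} (hab : a + b = m) {I : Finset (Fin m)}
    (hI : I.card = a) {f : Fin m → ℕ} {x y : ℕ} (hx : ∀ i ∈ I, f i = x) (hy : ∀ i ∉ I, f i = y) :
    ∏ i, f i = x ^ a * y ^ b := by
  have hIc : Iᶜ.card = b := by
    rw [Finset.card_compl, Fintype.card_fin, hI]
    omega
  rw [← Finset.prod_mul_prod_compl I, Finset.prod_congr rfl hx,
    Finset.prod_congr rfl fun i hi => hy i (Finset.mem_compl.1 hi), Finset.prod_const,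
    Finset.prod_const, hI, hIc]

theorem Considerate.pow_mul_pow_le_ncard_codeSupport (hm : 1 ≤ m) {S : Fin m → Finset F}
    {s v j : ℕ} (hs : ∀ i, (S i).card = s)
    (hcons : Considerate S (fun _ => v) (fun _ => j)) {a b z : ℕ} (hab : a + b = m)
    (hz : z ≤ j - v + 1) (hz1 : 1 ≤ z) (hz2 : 0 < b → 2 ≤ z) {W : Submodule F (Point S → F)}
    (hW1 : W ≤ code S (L₁ fun _ => j)) (hW2 : W ⊓ code S (L₂ (fun _ => v) fun _ => j) = ⊥)
    (hW : Module.finrank F W = z ^ a * (z - 1) ^ b) :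
    (s + z - j - 1) ^ a * (s + z - j - 2) ^ b ≤ (codeSupport W).ncard := by
  obtain ⟨d, rfl⟩ := Nat.exists_eq_add_of_le' hm
  have hvj : v < j ∧ j < s := by
    have := hcons.1 0
    rwa [hs] at this
  obtain ⟨K, hK1, hK2, hK3⟩ := exists_subset_diamond_D_le (fun i => (hcons.1 i).2) hW1 hW2
  have hpos : 1 ≤ z ^ a * (z - 1) ^ b := by
    rcases Nat.eq_zero_or_pos b with rfl | hb
    · simpa [Nat.succ_le_iff] using Nat.pow_pos hz1
    · have := hz2 hb
      exact Nat.mul_pos (Nat.pow_pos hz1) (Nat.pow_pos (by omega))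
  have hbox : z ^ a * (z - 1) ^ b ≤ (box (m := d + 1) (fun _ => v) fun _ => j).card := by
    have h1 : (box (m := d + 1) (fun _ => v) fun _ => j).card = (j + 1 - v) ^ (a + b) := by
      simp [box, Pi.card_Icc, hab]
    rw [h1, pow_add]
    exact Nat.mul_le_mul (Nat.pow_le_pow_left (by omega) a) (Nat.pow_le_pow_left (by omega) b)
  obtain ⟨K', hK'1, hK'2, hK'3⟩ := hcons.2 _ hpos hbox
  have h1 := pow_mul_pow_le_card_thicken hz1 hz2 hab (s - 1 - j) K' hK'2
  have h2 := card_thicken_le_D S (c := s - 1 - j) (fun i => by rw [hs]; omega) hK'1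
  rw [show s - 1 - j + z = s + z - j - 1 by omega,
    show s - 1 - j + (z - 1) = s + z - j - 2 by omega] at h1
  exact h1.trans (h2.trans ((hK'3 K hK1 (hK2.trans hW)).trans hK3))

end MonomialCartesian

-- The side lengths add `z` before subtracting: as j < s and 1 ≤ z, truncation then never occurs,
-- whereas `s - j - 2` would truncate for s = j + 1.
open MonomialCartesian in
theorem mainTheorem4 {F : Type*} [Field F] [Fintype F] (m : ℕ) (hm : 2 ≤ m)
    (S : Fin m → Finset F) (s v j : ℕ) (hs : ∀ i, (S i).card = s)
    (hcons : MonomialCartesian.Considerate S (fun _ => v) (fun _ => j))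
    (P : CosetScheme (MonomialCartesian.code S (MonomialCartesian.L₂ (fun _ => v) (fun _ => j)))
      (MonomialCartesian.code S (MonomialCartesian.L₁ (fun _ => j))))
    (a b z e : ℕ) (hab : a + b = m) (he : e = z ^ a * (z - 1) ^ b)
    (hz : z ≤ j - v + 1) (hz1 : b = 0 → 1 ≤ z) (hz2 : 0 < b → 2 ≤ z) :
    Fintype.card (MonomialCartesian.Point S) = s ^ m ∧
    P.ℓ = (j - v + 1) ^ m ∧
    IsRelGenHammingWeight
      (MonomialCartesian.code S (MonomialCartesian.L₁ (fun _ => j)))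
      (MonomialCartesian.code S (MonomialCartesian.L₂ (fun _ => v) (fun _ => j)))
      e ((s + z - j - 1) ^ a * (s + z - j - 2) ^ b) ∧
    P.IsReconstructionNumber (P.ℓ - e + 1)
      (s ^ m - (s + z - j - 1) ^ a * (s + z - j - 2) ^ b + 1) ∧
    ∀ T : Fin m → Finset F, (∀ i, T i ⊆ S i) →
      (∃ I : Finset (Fin m), I.card = a ∧
        (∀ i ∈ I, (T i).card = s + z - j - 1) ∧ (∀ i ∉ I, (T i).card = s + z - j - 2)) →
      (∀ (r : Fin P.k₂ → F) (x : Fin P.ℓ → F),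
        P.information (MonomialCartesian.removeProduct S T) (P.encode r x) ≤ (P.ℓ : ℝ) - e) ∧
      P.MaximumNonQualifying (P.ℓ - e + 1) (MonomialCartesian.removeProduct S T) := by
  classical
  have hvj : v < j ∧ j < s := by
    have := hcons.1 ⟨0, by omega⟩
    rwa [hs] at this
  have hj : ∀ i, (fun _ : Fin m => j) i < (S i).card := fun i => (hcons.1 i).2
  have hz1' : 1 ≤ z := by
    rcases Nat.eq_zero_or_pos b with hb | hb
    · exact hz1 hb
    · have := hz2 hb
      omega
  have hpt : Fintype.card (Point S) = s ^ m := by simp [hs]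
  have hℓ : P.ℓ = (j - v + 1) ^ m := by
    have h1 := P.finrank_eq_add
    have hsub : L₂ (fun _ : Fin m => v) (fun _ => j) ⊆ L₁ fun _ => j := Finset.sdiff_subset
    have hbsub : box (fun _ : Fin m => v) (fun _ => j) ⊆ L₁ fun _ => j :=
      Finset.Icc_subset_Icc_left zero_le
    have h2 : (L₂ (fun _ : Fin m => v) (fun _ => j)).card
        = (L₁ fun _ : Fin m => j).card - (box (fun _ : Fin m => v) fun _ => j).card :=
      Finset.card_sdiff_of_subset hbsub
    have h3 := Finset.card_le_card hbsub
    have h4 : (box (fun _ : Fin m => v) fun _ => j).card = (j - v + 1) ^ m := by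
      simp [box, Pi.card_Icc, Nat.sub_add_comm hvj.1.le]
    rw [finrank_code (L₁_subset_delta hj), finrank_code (hsub.trans (L₁_subset_delta hj))] at h1
    omega
  have heℓ : e ≤ P.ℓ := by
    rw [hℓ, he, ← hab, pow_add]
    exact Nat.mul_le_mul (Nat.pow_le_pow_left (by omega) a) (Nat.pow_le_pow_left (by omega) b)
  set w := (s + z - j - 1) ^ a * (s + z - j - 2) ^ b with hw
  have hlower : ∀ W : Submodule F (Point S → F), W ≤ code S (L₁ fun _ => j) →
      W ⊓ code S (L₂ (fun _ => v) fun _ => j) = ⊥ → Module.finrank F W = e →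
      w ≤ (codeSupport W).ncard := fun W h1 h2 h3 =>
    hcons.pow_mul_pow_le_ncard_codeSupport (by omega) hs hab hz hz1' hz2 h1 h2 (h3.trans he)
  have hcardT : ∀ T : Fin m → Finset F, (∃ I : Finset (Fin m), I.card = a ∧
      (∀ i ∈ I, (T i).card = s + z - j - 1) ∧ (∀ i ∉ I, (T i).card = s + z - j - 2)) →
      ∏ i, (T i).card = w := fun T ⟨I, hI, hI1, hI2⟩ =>
    prod_ite_mem_eq_pow_mul_pow hab hI hI1 hI2
  have hupper : ∀ T : Fin m → Finset F, (∀ i, T i ⊆ S i) →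
      (∃ I : Finset (Fin m), I.card = a ∧
        (∀ i ∈ I, (T i).card = s + z - j - 1) ∧ (∀ i ∉ I, (T i).card = s + z - j - 2)) →
      ∃ W : Submodule F (Point S → F), W ≤ code S (L₁ fun _ => j) ∧
        W ⊓ code S (L₂ (fun _ => v) fun _ => j) = ⊥ ∧ Module.finrank F W = e ∧
        codeSupport W = {p | ∀ i, (p i : F) ∈ T i} := by
    rintro T hT ⟨I, hI, hI1, hI2⟩
    have hz2' : ∀ i ∉ I, 2 ≤ z := by
      refine fun i hi => hz2 ?_
      have := Finset.card_lt_univ_of_notMem hi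
      rw [Fintype.card_fin, hI] at this
      omega
    obtain ⟨W, h1, h2, h3, h4⟩ := exists_submodule_codeSupport_eq (v := fun _ => v)
      (u := fun i => if i ∈ I then z else z - 1) hj hT
      (fun i => by
        by_cases hi : i ∈ I
        · simpa [hi] using hz1'
        · have := hz2' i hi
          simp only [hi, if_false]
          omega)
      (fun i => by
        by_cases hi : i ∈ I
        · simp only [hi, if_true, hI1 i hi, hs]
          omega
        · have := hz2' i hi
          simp only [hi, if_false, hI2 i hi, hs]
          omega)
      (fun i => by
        by_cases hi : i ∈ I <;> simp only [hi, if_true, if_false] <;> omega)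
    refine ⟨W, h1, h2, h3.trans ?_, h4⟩
    rw [he]
    exact prod_ite_mem_eq_pow_mul_pow hab hI (fun i hi => if_pos hi) (fun i hi => if_neg hi)
  have hrank : ∀ T : Fin m → Finset F, (∀ i, T i ⊆ S i) →
      (∃ I : Finset (Fin m), I.card = a ∧
        (∀ i ∈ I, (T i).card = s + z - j - 1) ∧ (∀ i ∉ I, (T i).card = s + z - j - 2)) →
      e ≤ Module.finrank F (P.hiddenSecrets (removeProduct S T)) := by
    intro T hT hI
    obtain ⟨W, h1, h2, h3, h4⟩ := hupper T hT hI
    rw [← h3]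
    refine P.finrank_le_finrank_hiddenSecrets _ h1 h2 fun c hc p hp => ?_
    by_contra h
    have hmem : p ∈ codeSupport W := ⟨c, hc, h⟩
    rw [h4] at hmem
    exact (Finset.mem_filter.1 hp).2 hmem
  -- The complement of `B` contains the support of an e-dimensional `W`, which has at least `w`
  -- points.
  have hnonqual : ∀ B : Finset (Point S), P.NonQualifying (P.ℓ - e + 1) B →
      B.card ≤ s ^ m - w := by
    intro B hB
    rw [P.nonQualifying_iff B heℓ] at hB
    obtain ⟨W, h1, h2, h3, h4⟩ := P.exists_submodule_of_le_finrank_hiddenSecrets B hB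
    have h5 : codeSupport W ⊆ ((Bᶜ : Finset (Point S)) : Set (Point S)) := by
      rintro p ⟨c, hc, hcp⟩
      rw [Finset.mem_coe, Finset.mem_compl]
      exact fun hp => hcp (h4 c hc p hp)
    have h6 := Set.ncard_le_ncard h5 (Finset.finite_toSet _)
    rw [Set.ncard_coe_finset, Finset.card_compl, hpt] at h6
    have h7 := hlower W h1 h2 h3
    have h8 := Finset.card_le_univ B
    rw [hpt] at h8
    omega
  obtain ⟨T₀, hT₀, hI₀⟩ : ∃ T : Fin m → Finset F, (∀ i, T i ⊆ S i) ∧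
      ∃ I : Finset (Fin m), I.card = a ∧
        (∀ i ∈ I, (T i).card = s + z - j - 1) ∧ (∀ i ∉ I, (T i).card = s + z - j - 2) := by
    obtain ⟨I, -, hI⟩ := Finset.exists_subset_card_eq
      (s := (Finset.univ : Finset (Fin m))) (n := a)
      (by rw [Finset.card_univ, Fintype.card_fin]; omega)
    have hex : ∀ i, ∃ U ⊆ S i, U.card = if i ∈ I then s + z - j - 1 else s + z - j - 2 := fun i =>
      Finset.exists_subset_card_eq (by rw [hs]; split_ifs <;> omega)
    choose T hT hTc using hex
    exact ⟨T, hT, I, hI, fun i hi => by rw [hTc, if_pos hi], fun i hi => by rw [hTc, if_neg hi]⟩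
  refine ⟨hpt, hℓ, ⟨?_, ?_⟩, ⟨?_, ?_⟩, fun T hT hI => ⟨fun r x => ?_, ?_, fun B hB => ?_⟩⟩
  · obtain ⟨W, h1, h2, h3, h4⟩ := hupper T₀ hT₀ hI₀
    exact ⟨W, h1, h2, h3, by rw [h4, ncard_setOf_forall_mem hT₀, hcardT T₀ hI₀]⟩
  · rintro _ ⟨W, h1, h2, h3, rfl⟩
    exact hlower W h1 h2 h3
  · intro A hA
    by_contra h
    have := hnonqual A h
    omega
  · intro r hr
    by_contra hlt
    -- Failing to qualify passes to subsets, so a non-qualifying set exists in every size up to `s ^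
    -- m - w`.
    have hle : r ≤ (removeProduct S T₀).card := by
      rw [card_removeProduct hT₀, hcardT T₀ hI₀, hpt]
      omega
    obtain ⟨A, hA, hAr⟩ := Finset.exists_subset_card_eq hle
    refine (P.nonQualifying_iff A heℓ).2 ((hrank T₀ hT₀ hI₀).trans ?_) (hr A hAr)
    exact Submodule.finrank_mono (P.hiddenSecrets_anti hA)
  · rw [P.information_encode]
    have := hrank T hT hI
    have : (e : ℝ) ≤ Module.finrank F (P.hiddenSecrets (removeProduct S T)) := by
      exact_mod_cast this
    linarith
  · exact (P.nonQualifying_iff _ heℓ).2 (hrank T hT hI)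
  · rw [card_removeProduct hT, hcardT T hI, hpt]
    exact hnonqual B hB
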